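/- Let $q$ be a prime power and let $s,k,h$ be integers with $s\ge 3$, $s\ne 4$ and $0\le h<k$; put $n=sk+h$. *Construction.* For $1\le i\le s-1$ let $P_i$ be the companion matrix (ones on the superdiagonal, last row $(-a_0,\dots,-a_{d-1})$) of a primitive polynomial $x^d+a_{d-1}x^{d-1}+\dots+a_0$ of degree $d=ik+h$ over $\mathbb F_q$, that is, a monic irreducible polynomial whose roots generate $\mathbb F_{q^d}^*$. Let $G_i\le \mathrm{GL}_n(\mathbb F_q)$ be the cyclic group generated by $\mathrm{diag}(I_{(s-i-1)k},I_k,P_i)$. For a matrix $X$ write $X^{(j)}$ for the matrix of its first $j$ rows and $X^{[j]}$ for the matrix of its remaining rows. Define the $(n-1)\times n$ matrices $$A_i=\begin{bmatrix}0&I_k&I_{ik+h}^{(k)}\\0&0&I_{ik+h}^{[k]}\\I_{(s-i-1)k}&0&0\\0&0&I_{ik+h}^{(k-1)}\end{bmatrix},\qquad B_i=\begin{bmatrix}0&I_k&0\\0&0&I_{ik+h}^{[k]}\\I_{(s-i-1)k}&0&0\\0&0&I_{ik+h}^{(k-1)}\end{bmatrix},$$ and let $M$ consist of the first $n-1$ rows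 of the $n\times n$ matrix with ones on the antidiagonal and zeros elsewhere. Let $\mathcal W$ be the set of all matrices $A_ig$, $B_i$, $M$ with $1\le i\le s-1$ and $g\in G_i$. Writing $\mathrm{rs}$ for the row space, put $$\mathscr C=\{\mathrm{rs}(W): W\in\mathcal W\},\qquad \mathcal C=\{(\mathrm{rs}(W^{(1)}),\mathrm{rs}(W^{(2)}),\dots,\mathrm{rs}(W^{(n-1)})): W\in\mathcal W\}.$$ Let $\mathbf t=(t_1,\dots,t_r)$ be the vector $$\mathbf t=(1,2,\dots,k+h,\,2k+h,\,3k+h,\dots,(s-2)k+h,\,n-k,\,n-k+1,\dots,n-1)$$ (the entries from $2k+h$ to $(s-2)k+h$ increase by steps of $k$ and are absent if $s=3$), and let $$\mathcal C_{\mathbf t}=\{(\mathrm{rs}(W^{(t_1)}),\dots,\mathrm{rs}(W^{(t_r)})): W\in\mathcal W\}$$ be the truncation of $\mathcal C$ to $\mathbf t$. *Definitions.* A flag code of type $\mathbf t$ on $\mathbb F_q^n$ is a non-empty set of sequences $(F_1,\dots,F_r)$ of subspaces with $\{0\}\subsetneq F_1\subsetneq\dots\subsetneq F_r\subsetneq\mathbb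 F_q^n$ and $\dim F_j=t_j$. It is cardinality-consistent if, for each $j$, the set of the $j$-th entries of its members has the same cardinality as the code itself. Its distance $d_f$ is the minimum of $\sum_{j=1}^r\bigl(\dim(F_j+F'_j)-\dim(F_j\cap F'_j)\bigr)$ over pairs of distinct members. *Theorem.* $\mathcal C_{\mathbf t}$ is a cardinality-consistent flag code of type $\mathbf t$ on $\mathbb F_q^n$ with $$d_f(\mathcal C_{\mathbf t})=2k(s+h+k-2)\qquad\text{and}\qquad |\mathcal C_{\mathbf t}|=|\mathcal C|=|\mathscr C|=\sum_{i=1}^{s-1}q^{ik+h}+1 .$$ -/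

import Mathlib

open Polynomial

namespace FlagCodes

section General

variable {F : Type*} [Field F] {n r : ℕ}

/-- The subspace distance `dim (U + V) - dim (U ∩ V)` (the natural subtraction never truncates). -/
noncomputable def subspaceDist (U V : Submodule F (Fin n → F)) : ℕ :=
  Module.finrank F ↥(U ⊔ V) - Module.finrank F ↥(U ⊓ V)

/-- `t = (t₁, …, t_r)` is a type vector on `F ^ n`: `1 ≤ t₁ < ⋯ < t_r ≤ n - 1`. -/
def IsTypeVector (n : ℕ) (t : Fin r → ℕ) : Prop :=
  StrictMono t ∧ ∀ j, 1 ≤ t j ∧ t j < n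

/-- `X = (X₁, …, X_r)` is a flag of type `t` on `F ^ n`: a strictly increasing sequence of proper
non-zero subspaces with `dim X_j = t_j`. -/
def IsFlag (t : Fin r → ℕ) (X : Fin r → Submodule F (Fin n → F)) : Prop :=
  StrictMono X ∧ ∀ j, ⊥ < X j ∧ X j < ⊤ ∧ Module.finrank F (X j) = t j

/-- A flag code of type `t` on `F ^ n`: a non-empty set of flags of type `t`. -/
def IsFlagCode (t : Fin r → ℕ) (C : Set (Fin r → Submodule F (Fin n → F))) : Prop :=
  IsTypeVector n t ∧ C.Nonempty ∧ ∀ X ∈ C, IsFlag t X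

/-- The flag distance. -/
noncomputable def flagDist (X Y : Fin r → Submodule F (Fin n → F)) : ℕ :=
  ∑ j, subspaceDist (X j) (Y j)

/-- `δ` is the minimum flag distance of `C`: the minimum over pairs of distinct elements exists
and equals `δ`. -/
def HasMinDist (C : Set (Fin r → Submodule F (Fin n → F))) (δ : ℕ) : Prop :=
  IsLeast {d | ∃ X ∈ C, ∃ Y ∈ C, X ≠ Y ∧ d = flagDist X Y} δ

/-- The `j`-th projected code. -/
def projectedCode (C : Set (Fin r → Submodule F (Fin n → F))) (j : Fin r) :
    Set (Submodule F (Fin n → F)) :=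
  (fun X => X j) '' C

/-- Every projected code has as many elements as `C`. -/
def IsCardinalityConsistent (C : Set (Fin r → Submodule F (Fin n → F))) : Prop :=
  ∀ j, (projectedCode C j).ncard = C.ncard

/-- The row space of a matrix. -/
def rowSpace {m : ℕ} (W : Matrix (Fin m) (Fin n) F) : Submodule F (Fin n → F) :=
  Submodule.span F (Set.range fun i => W i)

/-- The row space of the submatrix formed by the first `j` rows of `W`. -/
def rowSpaceFirst {m : ℕ} (W : Matrix (Fin m) (Fin n) F) (j : ℕ) : Submodule F (Fin n → F) :=
  Submodule.span F {v | ∃ i : Fin m, (i : ℕ) < j ∧ v = W i}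

/-- A primitive polynomial over a finite field: a monic irreducible polynomial whose roots generate
the multiplicative group of the extension `F[x] / (f)`, which has `q ^ deg f - 1` elements. -/
def IsPrimitivePolynomial (f : F[X]) : Prop :=
  f.Monic ∧ Irreducible f ∧ orderOf (AdjoinRoot.root f) = Nat.card F ^ f.natDegree - 1

/-- Entries, with rows and columns numbered from `0`, of the companion matrix of the monic
polynomial `f = x ^ d + a_{d-1} x ^ (d-1) + ⋯ + a₀`: ones on the superdiagonal, and last row
`(-a₀, …, -a_{d-1})`. -/
def companionEntry (f : F[X]) (r c : ℕ) : F :=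
  if r + 1 = f.natDegree then -f.coeff c else if c = r + 1 then 1 else 0

end General

/-! The construction on `F ^ n` with `n = s * k + h`. Rows and columns are numbered from `0`.
The columns are split into blocks of widths `(s - i - 1) * k`, `k`, `i * k + h`, so that the last
two blocks start at columns `(s - i - 1) * k` and `(s - i) * k`. -/

section Construction

variable (F : Type*) [Field F] (s k h : ℕ)

/-- The block diagonal matrix `diag (I, I, P_i)` with blocks of sizes `(s - i - 1) * k`, `k` and
`i * k + h`, where `P_i` is the companion matrix of `f` (of degree `i * k + h`). -/
def blockGen (i : ℕ) (f : F[X]) : Matrix (Fin (s * k + h)) (Fin (s * k + h)) F :=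
  Matrix.of fun r c =>
    if (s - i) * k ≤ (r : ℕ) ∧ (s - i) * k ≤ (c : ℕ) then
      companionEntry f ((r : ℕ) - (s - i) * k) ((c : ℕ) - (s - i) * k)
    else if r = c then 1 else 0

/-- The cyclic group `G_i` generated by `diag (I, I, P_i)` in `GL_n(F)`. -/
def groupG (i : ℕ) (f : F[X]) : Subgroup (GL (Fin (s * k + h)) F) :=
  Subgroup.closure {g | (g : Matrix (Fin (s * k + h)) (Fin (s * k + h)) F) = blockGen F s k h i f}

/-- The matrix `A_i`, of size `(n - 1) × n`. With `I = I_{i * k + h}`, its block rows are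
`[0, I_k, first k rows of I]`, `[0, 0, remaining rows of I]`, `[I_{(s - i - 1) * k}, 0, 0]` and
`[0, 0, first k - 1 rows of I]`. -/
def matA (i : ℕ) : Matrix (Fin (s * k + h - 1)) (Fin (s * k + h)) F :=
  Matrix.of fun r c =>
    if (r : ℕ) < k then
      if (c : ℕ) = (s - i - 1) * k + r ∨ (c : ℕ) = (s - i) * k + r then 1 else 0
    else if (r : ℕ) < i * k + h then
      if (c : ℕ) = (s - i) * k + r then 1 else 0
    else if (r : ℕ) < (s - 1) * k + h then
      if (c : ℕ) = r - (i * k + h) then 1 else 0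
    else
      if (c : ℕ) = (s - i) * k + (r - ((s - 1) * k + h)) then 1 else 0

/-- The matrix `B_i`: like `A_i`, with first block row `[0, I_k, 0]`. -/
def matB (i : ℕ) : Matrix (Fin (s * k + h - 1)) (Fin (s * k + h)) F :=
  Matrix.of fun r c =>
    if (r : ℕ) < k then
      if (c : ℕ) = (s - i - 1) * k + r then 1 else 0
    else if (r : ℕ) < i * k + h then
      if (c : ℕ) = (s - i) * k + r then 1 else 0
    else if (r : ℕ) < (s - 1) * k + h then
      if (c : ℕ) = r - (i * k + h) then 1 else 0
    else
      if (c : ℕ) = (s - i) * k + (r - ((s - 1) * k + h)) then 1 else 0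

/-- The matrix `M`: the first `n - 1` rows of the `n × n` antidiagonal permutation matrix. -/
def matM : Matrix (Fin (s * k + h - 1)) (Fin (s * k + h)) F :=
  Matrix.of fun r c => if (r : ℕ) + c + 1 = s * k + h then 1 else 0

variable {F}

/-- The generator matrices `A_i g`, `B_i`, `M`, for `1 ≤ i ≤ s - 1` and `g ∈ G_i`, where `G_i` is
built from the polynomial `f i`. -/
def generatorMatrices (f : ℕ → F[X]) : Set (Matrix (Fin (s * k + h - 1)) (Fin (s * k + h)) F) :=
  {W | ∃ i, 1 ≤ i ∧ i ≤ s - 1 ∧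
      ((∃ g ∈ groupG F s k h i (f i),
        W = matA F s k h i * (g : Matrix (Fin (s * k + h)) (Fin (s * k + h)) F)) ∨
        W = matB F s k h i)} ∪ {matM F s k h}

/-- The subspace code formed by the row spaces of the generator matrices. -/
def subspaceCode (f : ℕ → F[X]) : Set (Submodule F (Fin (s * k + h) → F)) :=
  rowSpace '' generatorMatrices s k h f

/-- The code of all sequences `(W^(t₁), …, W^(t_r))`, where `W` runs over the generator matrices
and `W^(j)` is the row space of the first `j` rows of `W`. -/
def flagCode {r : ℕ} (f : ℕ → F[X]) (t : Fin r → ℕ) :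
    Set (Fin r → Submodule F (Fin (s * k + h) → F)) :=
  (fun W j => rowSpaceFirst W (t j)) '' generatorMatrices s k h f

end Construction

/-- The full type `(1, 2, …, n - 1)`. -/
def fullType (n : ℕ) : Fin (n - 1) → ℕ := fun j => j + 1

/-- The type `(1, 2, …, k + h, 2k + h, 3k + h, …, (s - 2)k + h, n - k, …, n - 1)` with
`n = s * k + h`: it has `k + h` entries in the first run, `s - 3` in the second (spaced by `k`),
and `k` in the third; note that `n - k = (s - 1) * k + h`. -/
def longType (s k h : ℕ) : Fin ((k + h) + (s - 3) + k) → ℕ := fun j =>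
  if (j : ℕ) < k + h then j + 1
  else if (j : ℕ) < (k + h) + (s - 3) then (j - (k + h) + 2) * k + h
  else (s - 1) * k + h + (j - ((k + h) + (s - 3)))

end FlagCodes

/-!
Fix a block `i`, let `α` be a root of the primitive polynomial `f i` and `K = F[α]`, and identify
the last block of columns with `K` through the basis `1, α, α ^ 2, …`. The companion matrix then
acts as multiplication by `α`, and since `α` is primitive, the matrices `A g` and `B` of the block
are indexed by `K`: the nonzero `β = α ^ j` give `A T ^ j` and `β = 0` gives `B`
(`generatorMatrices_eq_range`, with the rows in `blockRow`). Together with `M` this indexes all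
generator matrices by a set with `∑ q ^ (i * k + h) + 1` elements.

The theorem follows from one estimate: for different indices and a central dimension `t`
(`IsCentralDim`), the spans `U` and `U'` of the first `t` rows satisfy `dim (U ∩ U') ≤ t - k`
(`finrank_inf_codeRow_add_le`). Since the rows are independent, this gives a subspace distance of at
least `2 * min t k (n - t)` at every entry of the type (`le_subspaceDist_codeRow`); the terms add up
to the stated distance (`sum_min_longType`), and all of them are attained by `A` and `B` of the
largest block (`subspaceDist_codeRow_last_le`). As the bound is positive, different indices give
different subspaces at every entry of the type, whence all the cardinalities.

The estimate is proved by exhibiting either a map onto `F ^ k` that kills one of the spaces and is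
onto on the other, or a `k`-dimensional subspace of one that is disjoint from the other. Inside one
block, a common vector of the spaces for nonzero `β ≠ β'` has a last block `y ∈ K` for which both
`y / β` and `y / β'` lie in the span of `1, …, α ^ (t - 1)` and share their first `k` coordinates,
so the injective map `y ↦ y / β - y / β'` lands in a space of dimension `t - k`; against `β = 0` the
map `y ↦ y` serves. For long prefixes the `k` linear forms of `exists_annihilator` do the work. The
one pair of blocks for which the estimate can fail, `B` of the largest block against the block two
below it, is where `s ≠ 4` enters
(`finrank_inf_blockRow_add_le_of_eq_zero`).
-/

namespace FlagCodes

/-! ### Dimension counts for intersections -/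

section Dimension

variable {F V : Type*} [Field F] [AddCommGroup V] [Module F V]

/-- The span of the first `t` terms of a sequence of vectors. -/
def prefixSpan (F : Type*) {V : Type*} [Field F] [AddCommGroup V] [Module F V]
    (R : ℕ → V) (t : ℕ) : Submodule F V :=
  Submodule.span F (R '' Set.Iio t)

theorem mem_prefixSpan {R : ℕ → V} {r t : ℕ} (h : r < t) : R r ∈ prefixSpan F R t :=
  Submodule.subset_span ⟨r, h, rfl⟩

theorem prefixSpan_mono (R : ℕ → V) : Monotone (prefixSpan F R) := fun _ _ h =>
  Submodule.span_mono (Set.image_mono (Set.Iio_subset_Iio h))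

theorem prefixSpan_le_iff {R : ℕ → V} {t : ℕ} {S : Submodule F V} :
    prefixSpan F R t ≤ S ↔ ∀ r < t, R r ∈ S := by
  rw [prefixSpan, Submodule.span_le]
  simp [Set.subset_def]

instance finiteDimensional_prefixSpan (R : ℕ → V) (t : ℕ) :
    FiniteDimensional F (prefixSpan F R t) :=
  FiniteDimensional.span_of_finite F ((Set.finite_Iio t).image R)

theorem finrank_prefixSpan_le (R : ℕ → V) (t : ℕ) :
    Module.finrank F (prefixSpan F R t) ≤ t := by
  classical
  have h1 := finrank_span_finset_le_card (R := F) ((Finset.range t).image R)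
  have h2 : ((Finset.range t).image R).card ≤ t := by
    simpa using Finset.card_image_le (s := Finset.range t) (f := R)
  have h3 : (((Finset.range t).image R : Finset V) : Set V) = R '' Set.Iio t := by
    simp
  rw [Set.finrank, h3] at h1
  exact h1.trans h2

/-- If `φ` kills `U` and maps `U'` onto a `k`-dimensional space, then `U ∩ U'` has codimension at
least `k` in `U'`. -/
theorem finrank_inf_add_le_of_map_eq_top {k t : ℕ} {U U' : Submodule F V} [FiniteDimensional F U']
    (φ : V →ₗ[F] (Fin k → F)) (hU : U ≤ LinearMap.ker φ) (hU' : U'.map φ = ⊤)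
    (ht : Module.finrank F U' ≤ t) : Module.finrank F ↥(U ⊓ U') + k ≤ t := by
  have h := LinearMap.finrank_range_add_finrank_ker (φ.domRestrict U')
  have hr : LinearMap.range (φ.domRestrict U') = ⊤ := by
    rw [LinearMap.range_domRestrict, hU']
  rw [hr, finrank_top, Module.finrank_fin_fun] at h
  have hk : Module.finrank F ↥(U ⊓ U') ≤ Module.finrank F (LinearMap.ker (φ.domRestrict U')) := by
    let g : ↥(U ⊓ U') →ₗ[F] LinearMap.ker (φ.domRestrict U') :=
      LinearMap.codRestrict _ (Submodule.inclusion (inf_le_right : U ⊓ U' ≤ U')) fun x => by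
        simpa [LinearMap.mem_ker] using hU x.2.1
    refine LinearMap.finrank_le_finrank_of_injective (f := g) fun x y hxy => ?_
    have := congrArg (fun z : LinearMap.ker (φ.domRestrict U') => ((z : U') : V)) hxy
    exact Subtype.ext this
  omega

/-- If `U` contains a `k`-dimensional space that is disjoint from `U'`, then `U ∩ U'` has codimension
at least `k` in `U`. -/
theorem finrank_inf_add_le_of_disjoint {k t : ℕ} {U U' Z : Submodule F V} [FiniteDimensional F U]
    (hZ : Z ≤ U) (hd : Disjoint Z U') (hk : k ≤ Module.finrank F Z)
    (ht : Module.finrank F U ≤ t) : Module.finrank F ↥(U ⊓ U') + k ≤ t := by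
  have : FiniteDimensional F Z := Submodule.finiteDimensional_of_le hZ
  have : FiniteDimensional F ↥(U ⊓ U') := Submodule.finiteDimensional_of_le inf_le_left
  have h := Submodule.finrank_sup_add_finrank_inf_eq (U ⊓ U') Z
  have h0 : (U ⊓ U') ⊓ Z = ⊥ := by
    rw [← le_bot_iff]
    exact fun x hx => hd.le_bot ⟨hx.2, hx.1.2⟩
  rw [h0, finrank_bot] at h
  have := Submodule.finrank_mono (sup_le (inf_le_left : U ⊓ U' ≤ U) hZ)
  omega

end Dimension

/-! ### Coordinates and windows -/

section Coordinates

variable (F : Type*) [Field F] (n : ℕ)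

/-- The standard basis vector with its one in column `c`; it is zero if `c` is out of range. -/
def unitVec (c : ℕ) : Fin n → F := fun j => if (j : ℕ) = c then 1 else 0

/-- The coordinate in column `c`, read as zero if `c` is out of range. -/
def coordAt (c : ℕ) : (Fin n → F) →ₗ[F] F where
  toFun v := if h : c < n then v ⟨c, h⟩ else 0
  map_add' v w := by split_ifs <;> simp
  map_smul' a v := by split_ifs <;> simp

/-- The coordinates in the `k` consecutive columns that start at `b`. -/
def window (k b : ℕ) : (Fin n → F) →ₗ[F] (Fin k → F) :=
  LinearMap.pi fun r => coordAt F n (b + r)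

variable {F n}

theorem coordAt_unitVec {c : ℕ} (hc : c < n) (c' : ℕ) :
    coordAt F n c (unitVec F n c') = if c = c' then 1 else 0 := by
  simp [coordAt, unitVec, hc]

theorem coordAt_unitVec_of_ne {c c' : ℕ} (h : c ≠ c') : coordAt F n c (unitVec F n c') = 0 := by
  simp [coordAt, unitVec, h]

theorem window_unitVec_self {k b : ℕ} (r : Fin k) (h : b + r < n) :
    window F n k b (unitVec F n (b + r)) = Pi.single r 1 := by
  ext j
  by_cases hj : j = r
  · subst hj
    simp [window, coordAt_unitVec h]
  · have : b + (j : ℕ) ≠ b + r := fun h => hj (Fin.ext (by omega))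
    simp [window, coordAt_unitVec_of_ne this, hj]

theorem window_unitVec_eq_zero {k b c : ℕ} (h : c < b ∨ b + k ≤ c) :
    window F n k b (unitVec F n c) = 0 := by
  ext j
  exact coordAt_unitVec_of_ne (by omega)

theorem eq_top_of_single_mem {k : ℕ} {S : Submodule F (Fin k → F)}
    (h : ∀ r, Pi.single r 1 ∈ S) : S = ⊤ := by
  rw [eq_top_iff, ← (Pi.basisFun F (Fin k)).span_eq, Submodule.span_le]
  rintro _ ⟨r, rfl⟩
  simpa using h r

theorem span_unitVec_eq_top : Submodule.span F (Set.range fun c : Fin n => unitVec F n c) = ⊤ := by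
  refine eq_top_of_single_mem fun r => Submodule.subset_span ⟨r, ?_⟩
  ext j
  simp [unitVec, Pi.single_apply, Fin.ext_iff]

end Coordinates

/-! ### A field embedded in a block of columns -/

section Block

variable {F K : Type*} [Field F] [Field K] [Algebra F K] (n b : ℕ) (pb : PowerBasis F K)

/-- The coordinates of an element of `K` with respect to a power basis, written into the columns
from `b` on. -/
noncomputable def blockVec : K →ₗ[F] (Fin n → F) :=
  pb.basis.constr F fun r => unitVec F n (b + r)

/-- The element of `K` whose coordinates stand in the columns from `b` on. -/
noncomputable def blockElt : (Fin n → F) →ₗ[F] K :=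
  ∑ r : Fin pb.dim, (coordAt F n (b + r)).smulRight (pb.gen ^ (r : ℕ))

variable {n b pb}

theorem blockVec_gen_pow {r : ℕ} (hr : r < pb.dim) :
    blockVec n b pb (pb.gen ^ r) = unitVec F n (b + r) := by
  have := pb.basis.constr_basis F (fun r => unitVec F n (b + r)) ⟨r, hr⟩
  rwa [pb.basis_eq_pow] at this

/-- Linear maps on `K` that agree on the power basis are equal. -/
theorem ext_gen_pow {W : Type*} [AddCommGroup W] [Module F W] {g g' : K →ₗ[F] W}
    (h : ∀ r < pb.dim, g (pb.gen ^ r) = g' (pb.gen ^ r)) : g = g' :=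
  pb.basis.ext fun r => by simpa [pb.basis_eq_pow] using h r r.2

theorem blockElt_unitVec_of_lt {c : ℕ} (h : c < b) : blockElt n b pb (unitVec F n c) = 0 := by
  simp only [blockElt, LinearMap.sum_apply, LinearMap.smulRight_apply]
  exact Finset.sum_eq_zero fun r _ => by rw [coordAt_unitVec_of_ne (by omega), zero_smul]

theorem blockElt_blockVec (h : b + pb.dim ≤ n) (z : K) :
    blockElt n b pb (blockVec n b pb z) = z := by
  have : (blockElt n b pb).comp (blockVec n b pb) = LinearMap.id (R := F) := by
    refine ext_gen_pow (pb := pb) fun r hr => ?_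
    rw [LinearMap.comp_apply, blockVec_gen_pow hr]
    simp only [blockElt, LinearMap.sum_apply, LinearMap.smulRight_apply, LinearMap.id_apply]
    rw [Finset.sum_eq_single ⟨r, hr⟩]
    · simp [coordAt_unitVec (F := F) (show b + r < n by omega)]
    · intro j _ hj
      rw [coordAt_unitVec_of_ne, zero_smul]
      exact fun h => hj (Fin.ext (by simpa using h))
    · simp
  exact LinearMap.congr_fun this z

theorem window_blockVec_eq_zero {k b' : ℕ} (h : b' + k ≤ b) (z : K) :
    window F n k b' (blockVec n b pb z) = 0 := by
  have : (window F n k b').comp (blockVec n b pb) = 0 := by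
    refine ext_gen_pow (pb := pb) fun r hr => ?_
    rw [LinearMap.comp_apply, blockVec_gen_pow hr, window_unitVec_eq_zero (by omega)]
    rfl
  exact LinearMap.congr_fun this z

/-- For `δ ≠ 0` the elements `α ^ r * δ` span `K`, so a subspace contains the whole image of a
linear map as soon as it contains the images of these elements. -/
theorem mem_of_gen_pow_mul_mem (pb : PowerBasis F K) {W : Type*} [AddCommGroup W] [Module F W]
    {S : Submodule F W}
    (g : K →ₗ[F] W) {δ : K} (hδ : δ ≠ 0) (h : ∀ r < pb.dim, g (pb.gen ^ r * δ) ∈ S) (z : K) :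
    g z ∈ S := by
  have h1 : z = (z / δ) * δ := by field_simp
  have h2 := pb.basis.sum_repr (z / δ)
  rw [h1, ← h2, Finset.sum_mul, map_sum]
  refine S.sum_mem fun r _ => ?_
  rw [smul_mul_assoc, map_smul, pb.basis_eq_pow]
  exact S.smul_mem _ (h r r.2)

theorem range_window_comp_blockVec {k b' : ℕ} (hb : b ≤ b') (hb' : b' + k ≤ b + pb.dim)
    (hn : b + pb.dim ≤ n) :
    LinearMap.range ((window F n k b').comp (blockVec n b pb)) = ⊤ := by
  refine eq_top_of_single_mem fun r => ⟨pb.gen ^ (b' + r - b), ?_⟩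
  have := r.2
  rw [LinearMap.comp_apply, blockVec_gen_pow (by omega),
    show b + (b' + r - b) = b' + (r : ℕ) by omega, window_unitVec_self _ (by omega)]

end Block

/-! ### Rows of the generator matrices -/

section Rows

variable {F K : Type*} [Field F] [Field K] [Algebra F K] (n k c : ℕ) (pb : PowerBasis F K)

open Classical in
/-- The rows of the generator matrices attached to one block, indexed by `β ∈ K`. Here `c` is the
width of the first block of columns, the second has width `k`, and `K` sits in the last block. For
`β = α ^ j` these are the rows of `A T ^ j`, where `T` is the block generator; for `β = 0` they are
the rows of `B`, in which the lower rows carry the powers of `α` without a factor. -/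
noncomputable def blockRow (β : K) (r : ℕ) : Fin n → F :=
  if r < k then unitVec F n (c + r) + blockVec n (c + k) pb (pb.gen ^ r * β)
  else if r < pb.dim then blockVec n (c + k) pb (pb.gen ^ r * if β = 0 then 1 else β)
  else if r < c + pb.dim then unitVec F n (r - pb.dim)
  else blockVec n (c + k) pb (pb.gen ^ (r - (c + pb.dim)) * if β = 0 then 1 else β)

/-- The rows of the antidiagonal permutation matrix. -/
def antiRow (F : Type*) [Field F] (n : ℕ) (r : ℕ) : Fin n → F := unitVec F n (n - 1 - r)

variable {n k c pb}

theorem blockRow_of_lt_k {β : K} {r : ℕ} (h : r < k) : blockRow n k c pb β r =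
    unitVec F n (c + r) + blockVec n (c + k) pb (pb.gen ^ r * β) := by simp [blockRow, h]

theorem blockRow_of_lt_dim {β : K} {r : ℕ} (hk : k ≤ r) (h : r < pb.dim) (hβ : β ≠ 0) :
    blockRow n k c pb β r = blockVec n (c + k) pb (pb.gen ^ r * β) := by
  simp [blockRow, h, hβ, not_lt.2 hk]

theorem blockRow_zero_of_lt_dim {r : ℕ} (hk : k ≤ r) (h : r < pb.dim) :
    blockRow n k c pb (0 : K) r = unitVec F n (c + k + r) := by
  simp [blockRow, h, not_lt.2 hk, blockVec_gen_pow h]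

theorem blockRow_zero_of_lt_k {r : ℕ} (h : r < k) :
    blockRow n k c pb (0 : K) r = unitVec F n (c + r) := by
  simp [blockRow, h]

theorem exists_blockRow_of_lt_dim (β : K) {r : ℕ} (hk : k ≤ r) (h : r < pb.dim) :
    ∃ z, blockRow n k c pb β r = blockVec n (c + k) pb z := by
  simp only [blockRow, h, not_lt.2 hk, if_true, if_false]
  exact ⟨_, rfl⟩

theorem blockRow_of_dim_le {β : K} {r : ℕ} (hk : k ≤ pb.dim) (h : pb.dim ≤ r)
    (hr : r < c + pb.dim) : blockRow n k c pb β r = unitVec F n (r - pb.dim) := by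
  simp [blockRow, hr, not_lt.2 h, not_lt.2 (hk.trans h)]

theorem blockRow_of_le {β : K} {r : ℕ} (hk : k ≤ pb.dim) (h : c + pb.dim ≤ r) (hβ : β ≠ 0) :
    blockRow n k c pb β r = blockVec n (c + k) pb (pb.gen ^ (r - (c + pb.dim)) * β) := by
  simp [blockRow, hβ, not_lt.2 h, show ¬ r < k by omega, show ¬ r < pb.dim by omega]

theorem blockRow_zero_of_le {r : ℕ} (hk : k ≤ pb.dim) (h : c + pb.dim ≤ r)
    (hr : r < c + pb.dim + k) :
    blockRow n k c pb (0 : K) r = unitVec F n (c + k + (r - (c + pb.dim))) := by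
  have : ¬ r < c + pb.dim := by omega
  simp [blockRow, this, show ¬ r < k by omega, show ¬ r < pb.dim by omega,
    blockVec_gen_pow (n := n) (b := c + k) (pb := pb) (r := r - (c + pb.dim)) (by omega)]

/-- A window that avoids the columns from `c` on kills the first `dim K` rows. -/
theorem window_blockRow_eq_zero {b : ℕ} (hb : b + k ≤ c) {β : K} {r : ℕ} (h : r < pb.dim) :
    window F n k b (blockRow n k c pb β r) = 0 := by
  rcases lt_or_ge r k with hk | hk
  · rw [blockRow_of_lt_k hk, map_add, window_unitVec_eq_zero (by omega),
      window_blockVec_eq_zero (by omega), add_zero]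
  · obtain ⟨z, hz⟩ := exists_blockRow_of_lt_dim (n := n) (c := c) β hk h
    rw [hz, window_blockVec_eq_zero (by omega)]

/-- The identity block in the first `k` rows makes the window at `c` surjective. -/
theorem map_window_prefixSpan_blockRow (hn : c + k + pb.dim = n) (β : K) {t : ℕ} (ht : k ≤ t) :
    (prefixSpan F (blockRow n k c pb β) t).map (window F n k c) = ⊤ := by
  refine eq_top_of_single_mem fun r => ⟨_, mem_prefixSpan (r.2.trans_le ht), ?_⟩
  have := r.2
  rw [blockRow_of_lt_k r.2, map_add, window_unitVec_self _ (by omega),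
    window_blockVec_eq_zero (by omega), add_zero]

/-- For every `β` there are `k` linear forms that vanish on the rows of index below
`c + dim K` and remain independent on the last block. Against another nonzero `β'` they read off
the first coordinates of `α ^ r * δ` for a fixed nonzero `δ`. -/
theorem exists_annihilator (hk : k ≤ pb.dim) (hn : c + k + pb.dim = n) (β : K) :
    ∃ φ : (Fin n → F) →ₗ[F] (Fin k → F),
      (∀ r < c + pb.dim, φ (blockRow n k c pb β r) = 0) ∧
      (∀ x < c, φ (unitVec F n x) = 0) ∧
      LinearMap.range (φ.comp (blockVec n (c + k) pb)) = ⊤ ∧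
      ∀ β' : K, β' ≠ 0 → β' ≠ β → ∃ δ : K, δ ≠ 0 ∧ ∀ r < pb.dim,
        φ (blockRow n k c pb β' r) =
          ((window F n k (c + k)).comp (blockVec n (c + k) pb)) (pb.gen ^ r * δ) := by
  have hrange := range_window_comp_blockVec (k := k) (n := n) (pb := pb) le_rfl
    (show c + k + k ≤ c + k + pb.dim by omega) hn.le
  by_cases hβ : β = 0
  · subst hβ
    refine ⟨window F n k (c + k), fun r hr => ?_, fun x hx => ?_, hrange, fun β' hβ' _ =>
      ⟨β', hβ', fun r hr => ?_⟩⟩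
    · rcases lt_or_ge r k with h | h
      · rw [blockRow_zero_of_lt_k h, window_unitVec_eq_zero (by omega)]
      rcases lt_or_ge r pb.dim with h' | h'
      · rw [blockRow_zero_of_lt_dim h h', window_unitVec_eq_zero (by omega)]
      · rw [blockRow_of_dim_le hk h' hr, window_unitVec_eq_zero (by omega)]
    · exact window_unitVec_eq_zero (by omega)
    · rcases lt_or_ge r k with h | h
      · rw [blockRow_of_lt_k h, map_add, window_unitVec_eq_zero (by omega), zero_add]
        rfl
      · rw [blockRow_of_lt_dim h hr hβ']
        rfl
  -- for `β ≠ 0`, compare the window at the identity block with the first coordinates of the last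
  -- block divided by `β`
  · set κ := (window F n k (c + k)).comp (blockVec n (c + k) pb) with hκ
    let φ : (Fin n → F) →ₗ[F] (Fin k → F) := window F n k c -
      κ.comp ((LinearMap.mulLeft F β⁻¹).comp (blockElt n (c + k) pb))
    have hφu : ∀ x < c, φ (unitVec F n x) = 0 := fun x hx => by
      simp [φ, window_unitVec_eq_zero (F := F) (n := n) (k := k) (Or.inl hx),
        blockElt_unitVec_of_lt (F := F) (n := n) (pb := pb) (show x < c + k by omega)]
    have hφκ : ∀ z, φ (blockVec n (c + k) pb z) = - κ (β⁻¹ * z) := fun z => by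
      simp [φ, window_blockVec_eq_zero, blockElt_blockVec hn.le]
    have hκr : ∀ r (h : r < k), κ (pb.gen ^ r) = Pi.single ⟨r, h⟩ 1 := fun r h => by
      rw [hκ, LinearMap.comp_apply, blockVec_gen_pow (by omega)]
      exact window_unitVec_self ⟨r, h⟩ (by simp; omega)
    have hκr' : ∀ r, k ≤ r → r < pb.dim → κ (pb.gen ^ r) = 0 := fun r h h' => by
      rw [hκ, LinearMap.comp_apply, blockVec_gen_pow h', window_unitVec_eq_zero (by omega)]
    have hφc : ∀ r (h : r < k), φ (unitVec F n (c + r)) = κ (pb.gen ^ r) := fun r h => by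
      rw [hκr r h]
      have := window_unitVec_self (F := F) (n := n) (b := c) ⟨r, h⟩ (by simp; omega)
      simp only at this
      simp [φ, this,
        blockElt_unitVec_of_lt (F := F) (n := n) (pb := pb) (show c + r < c + k by omega)]
    have hφrow : ∀ β' : K, β' ≠ 0 → ∀ r < pb.dim, φ (blockRow n k c pb β' r) =
        κ (pb.gen ^ r * (1 - β⁻¹ * β')) := fun β' hβ' r hr => by
      rcases lt_or_ge r k with h | h
      · rw [blockRow_of_lt_k h, map_add, hφc r h, hφκ, ← sub_eq_add_neg, ← map_sub]
        congr 1; ring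
      · rw [blockRow_of_lt_dim h hr hβ', hφκ]
        have : κ (pb.gen ^ r * (1 - β⁻¹ * β')) = κ (pb.gen ^ r) - κ (β⁻¹ * (pb.gen ^ r * β')) := by
          rw [← map_sub]; congr 1; ring
        rw [this, hκr' r h hr, zero_sub]
    refine ⟨φ, fun r hr => ?_, hφu, ?_, fun β' hβ' hne => ⟨1 - β⁻¹ * β', ?_, hφrow β' hβ'⟩⟩
    · rcases lt_or_ge r pb.dim with h' | h'
      · rw [hφrow β hβ r h', inv_mul_cancel₀ hβ, sub_self, mul_zero, map_zero]
      · rw [blockRow_of_dim_le hk h' hr]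
        exact hφu _ (by omega)
    · rw [eq_top_iff, ← hrange]
      rintro _ ⟨z, rfl⟩
      refine ⟨-(β * z), ?_⟩
      rw [LinearMap.comp_apply, hφκ, ← map_neg, mul_neg, neg_neg, inv_mul_cancel_left₀ hβ]
    · intro h0
      apply hne
      rwa [sub_eq_zero, eq_comm, inv_mul_eq_one₀ hβ, eq_comm] at h0

end Rows

/-! ### Intersections of prefix spans -/

section Pairs

variable {F K K' : Type*} [Field F] [Field K] [Algebra F K] [Field K'] [Algebra F K']
  {n k c c' t : ℕ} {pb : PowerBasis F K} {pb' : PowerBasis F K'} {β : K} {β' : K'}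

/-- Different blocks, short prefix: the window at the identity block of the larger block misses the
columns of the smaller one. -/
theorem finrank_inf_blockRow_add_le_of_le_dim (hn' : c' + k + pb'.dim = n) (hc : c' + k ≤ c)
    (hkt : k ≤ t) (ht : t ≤ pb.dim) :
    Module.finrank F ↥(prefixSpan F (blockRow n k c pb β) t ⊓
      prefixSpan F (blockRow n k c' pb' β') t) + k ≤ t :=
  finrank_inf_add_le_of_map_eq_top (window F n k c')
    (prefixSpan_le_iff.2 fun _ hr => window_blockRow_eq_zero hc (by omega))
    (map_window_prefixSpan_blockRow hn' β' hkt) (finrank_prefixSpan_le _ _)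

/-- Different blocks, prefix at least as long as the larger block: modulo its first columns, the
second prefix contains all columns of the last block of the first, on which the annihilator of the
first prefix is onto. -/
theorem finrank_inf_blockRow_add_le_of_dim_le (hk : k ≤ pb.dim) (hn : c + k + pb.dim = n)
    (hn' : c' + k + pb'.dim = n) (hc : c' + k ≤ c) (ht : pb'.dim ≤ t)
    (htn : t + k ≤ n) :
    Module.finrank F ↥(prefixSpan F (blockRow n k c pb β) t ⊓
      prefixSpan F (blockRow n k c' pb' β') t) + k ≤ t := by
  obtain ⟨φ, hφ, hφ0, hφr, -⟩ := exists_annihilator hk hn β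
  refine finrank_inf_add_le_of_map_eq_top φ (prefixSpan_le_iff.2 fun r hr => hφ r (by omega)) ?_
    (finrank_prefixSpan_le _ _)
  rw [eq_top_iff, ← hφr]
  rintro _ ⟨z, rfl⟩
  refine mem_of_gen_pow_mul_mem pb (φ.comp (blockVec n (c + k) pb)) one_ne_zero (fun r hr => ?_) z
  rw [mul_one, LinearMap.comp_apply, blockVec_gen_pow hr]
  by_cases hβ' : β' = 0
  · subst hβ'
    refine ⟨_, mem_prefixSpan (r := c - c' + r) (by omega), ?_⟩
    rw [blockRow_zero_of_lt_dim (by omega) (by omega),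
      show c' + k + (c - c' + r) = c + k + r by omega]
  · have h := mem_of_gen_pow_mul_mem pb' (φ.comp (blockVec n (c' + k) pb')) hβ'
      (S := (prefixSpan F (blockRow n k c' pb' β') t).map φ)
      (fun r hr => ⟨_, mem_prefixSpan (r := r) (by omega), ?_⟩) (pb'.gen ^ (c - c' + r))
    · rwa [LinearMap.comp_apply, blockVec_gen_pow (by omega),
        show c' + k + (c - c' + r) = c + k + r by omega] at h
    · rcases lt_or_ge r k with h | h
      · rw [blockRow_of_lt_k h, map_add, hφ0 _ (by omega), zero_add]
        rfl
      · rw [blockRow_of_lt_dim h hr hβ']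
        rfl

/-- On a prefix of length at most `dim K` with `β ≠ 0` the last block of a vector determines the
vector. -/
theorem eq_zero_of_blockElt_eq_zero (hn : c + k + pb.dim = n) (ht : t ≤ pb.dim) (hβ : β ≠ 0)
    {w : Fin n → F} (hw : w ∈ prefixSpan F (blockRow n k c pb β) t)
    (h0 : blockElt n (c + k) pb w = 0) : w = 0 := by
  let g : K →ₗ[F] (Fin n → F) := pb.basis.constr F fun r => blockRow n k c pb β r
  have hg : ∀ r < pb.dim, g (pb.gen ^ r) = blockRow n k c pb β r := fun r hr => by
    have := pb.basis.constr_basis F (fun r => blockRow n k c pb β r) ⟨r, hr⟩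
    rwa [pb.basis_eq_pow] at this
  have hle : prefixSpan F (blockRow n k c pb β) t ≤ LinearMap.eqLocus LinearMap.id
      (g.comp ((LinearMap.mulLeft F β⁻¹).comp (blockElt n (c + k) pb))) := by
    refine prefixSpan_le_iff.2 fun r hr => ?_
    have hr' : blockElt n (c + k) pb (blockRow n k c pb β r) = pb.gen ^ r * β := by
      rcases lt_or_ge r k with h | h
      · rw [blockRow_of_lt_k h, map_add, blockElt_unitVec_of_lt (by omega),
          blockElt_blockVec hn.le, zero_add]
      · rw [blockRow_of_lt_dim h (by omega) hβ, blockElt_blockVec hn.le]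
    rw [LinearMap.mem_eqLocus, LinearMap.id_apply, LinearMap.comp_apply, LinearMap.comp_apply, hr',
      LinearMap.mulLeft_apply, mul_comm, mul_inv_cancel_right₀ hβ, hg r (by omega)]
  have := hle hw
  rw [LinearMap.mem_eqLocus] at this
  simpa [h0] using this

theorem le_finrank_prefixSpan_unitVec (hk : k ≤ n) :
    k ≤ Module.finrank F (prefixSpan F (unitVec F n) k) := by
  have h : (prefixSpan F (unitVec F n) k).map (window F n k 0) = ⊤ :=
    eq_top_of_single_mem fun r => ⟨_, mem_prefixSpan r.2, by
      have := window_unitVec_self (F := F) (n := n) (b := 0) r (by omega)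
      rwa [zero_add] at this⟩
  have := Submodule.finrank_map_le (window F n k 0) (prefixSpan F (unitVec F n) k)
  rwa [h, finrank_top, Module.finrank_fin_fun] at this

/-- Different blocks, intermediate prefix: the first contains the first `k` columns, and the second
meets them trivially, since its vectors are determined by their last block. -/
theorem finrank_inf_blockRow_add_le_of_ne_zero (hk : k ≤ pb.dim) (hn : c + k + pb.dim = n)
    (hn' : c' + k + pb'.dim = n) (ht : pb.dim + k ≤ t) (ht' : t ≤ pb'.dim) (htn : t + k ≤ n)
    (hβ' : β' ≠ 0) :
    Module.finrank F ↥(prefixSpan F (blockRow n k c pb β) t ⊓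
      prefixSpan F (blockRow n k c' pb' β') t) + k ≤ t := by
  refine finrank_inf_add_le_of_disjoint (Z := prefixSpan F (unitVec F n) k)
    (prefixSpan_le_iff.2 fun r hr => ?_) ?_ (le_finrank_prefixSpan_unitVec (by omega))
    (finrank_prefixSpan_le _ _)
  · have := mem_prefixSpan (F := F) (R := blockRow n k c pb β) (r := pb.dim + r) (t := t) (by omega)
    rwa [blockRow_of_dim_le hk (by omega) (by omega), Nat.add_sub_cancel_left] at this
  · rw [Submodule.disjoint_def]
    intro w hw hw'
    refine eq_zero_of_blockElt_eq_zero hn' ht' hβ' hw' ?_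
    have : prefixSpan F (unitVec F n) k ≤ LinearMap.ker (blockElt n (c' + k) pb') :=
      prefixSpan_le_iff.2 fun r hr => blockElt_unitVec_of_lt (by omega)
    exact this hw

/-- Different blocks, intermediate prefix: the first contains the first `k` columns, and the second
vanishes on them because its own first block of columns is not empty. -/
theorem finrank_inf_blockRow_add_le_of_k_le (hk : k ≤ pb.dim) (hn : c + k + pb.dim = n)
    (ht : pb.dim + k ≤ t) (ht' : t ≤ pb'.dim) (htn : t + k ≤ n) (hc' : k ≤ c') :
    Module.finrank F ↥(prefixSpan F (blockRow n k c pb β) t ⊓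
      prefixSpan F (blockRow n k c' pb' β') t) + k ≤ t := by
  rw [inf_comm]
  refine finrank_inf_add_le_of_map_eq_top (window F n k 0)
    (prefixSpan_le_iff.2 fun _ hr => window_blockRow_eq_zero (by omega) (by omega))
    (eq_top_of_single_mem fun r => ⟨_, mem_prefixSpan (r := pb.dim + r) (by omega), ?_⟩)
    (finrank_prefixSpan_le _ _)
  have := window_unitVec_self (F := F) (n := n) (b := 0) r (by omega)
  rw [blockRow_of_dim_le hk (by omega) (by omega), Nat.add_sub_cancel_left]
  rwa [zero_add] at this

/-- The rows of `B` with an empty first block of columns, against a long prefix for a smaller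
block. Either a window between the columns reached by the two prefixes separates them, or
`c = 2 * k` and the last `k` columns do. The latter case is the one that fails for `s = 4`, where
`dim K < 2 * k`. -/
theorem finrank_inf_blockRow_add_le_of_eq_zero (hk : k ≤ pb.dim) (hn : c + k + pb.dim = n)
    (hn' : k + pb'.dim = n) (ht : pb.dim + k ≤ t) (ht' : t ≤ pb'.dim) (htn : t + k + k ≤ n)
    (hc : 3 * k ≤ c ∨ c = 2 * k ∧ 2 * k ≤ pb.dim) :
    Module.finrank F ↥(prefixSpan F (blockRow n k c pb β) t ⊓
      prefixSpan F (blockRow n k 0 pb' (0 : K')) t) + k ≤ t := by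
  rcases hc with hc | ⟨hc, hd⟩
  · refine finrank_inf_add_le_of_map_eq_top (window F n k (max (2 * k) (t - pb.dim)))
      (prefixSpan_le_iff.2 fun r hr => ?_)
      (eq_top_of_single_mem fun r =>
        ⟨_, mem_prefixSpan (r := max (2 * k) (t - pb.dim) + r - k) (by omega), ?_⟩)
      (finrank_prefixSpan_le _ _)
    · rcases lt_or_ge r pb.dim with h | h
      · exact window_blockRow_eq_zero (by omega) h
      · rw [blockRow_of_dim_le hk h (by omega)]
        exact window_unitVec_eq_zero (by omega)
    · rw [blockRow_zero_of_lt_dim (by omega) (by omega), show 0 + k +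
        (max (2 * k) (t - pb.dim) + r - k) = max (2 * k) (t - pb.dim) + r by omega]
      exact window_unitVec_self r (by omega)
  · rw [inf_comm]
    refine finrank_inf_add_le_of_map_eq_top (window F n k (n - k))
      (prefixSpan_le_iff.2 fun r hr => ?_) ?_ (finrank_prefixSpan_le _ _)
    · rcases lt_or_ge r k with h | h
      · rw [blockRow_zero_of_lt_k h]
        exact window_unitVec_eq_zero (by omega)
      · rw [blockRow_zero_of_lt_dim h (by omega)]
        exact window_unitVec_eq_zero (by omega)
    · by_cases hβ : β = 0
      · subst hβ
        refine eq_top_of_single_mem fun r =>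
          ⟨_, mem_prefixSpan (r := pb.dim - k + r) (by omega), ?_⟩
        rw [blockRow_zero_of_lt_dim (by omega) (by omega),
          show c + k + (pb.dim - k + r) = n - k + r by omega]
        exact window_unitVec_self r (by omega)
      · rw [eq_top_iff, ← range_window_comp_blockVec (F := F) (b := c + k) (b' := n - k) (k := k)
          (n := n) (pb := pb) (by omega) (by omega) hn.le]
        rintro _ ⟨z, rfl⟩
        refine mem_of_gen_pow_mul_mem pb
          ((window F n k (n - k)).comp (blockVec n (c + k) pb)) hβ
          (S := (prefixSpan F (blockRow n k c pb β) t).map (window F n k (n - k)))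
          (fun r hr => ⟨_, mem_prefixSpan (r := r) (by omega), ?_⟩) z
        rcases lt_or_ge r k with h | h
        · rw [blockRow_of_lt_k h, map_add, window_unitVec_eq_zero (by omega), zero_add]
          rfl
        · rw [blockRow_of_lt_dim h hr hβ]
          rfl

/-- Two prefixes for the same block, with length at least `dim K`: the annihilator of the first maps
the second onto the first `k` coordinates of `K * δ = K`. -/
theorem finrank_inf_blockRow_add_le_of_ne_of_dim_le {β' : K} (hk : k ≤ pb.dim)
    (hn : c + k + pb.dim = n) (ht : pb.dim ≤ t) (htn : t + k ≤ n) (hβ' : β' ≠ 0) (hne : β' ≠ β) :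
    Module.finrank F ↥(prefixSpan F (blockRow n k c pb β) t ⊓
      prefixSpan F (blockRow n k c pb β') t) + k ≤ t := by
  obtain ⟨φ, hφ, -, -, hφ'⟩ := exists_annihilator hk hn β
  obtain ⟨δ, hδ, hφδ⟩ := hφ' β' hβ' hne
  refine finrank_inf_add_le_of_map_eq_top φ (prefixSpan_le_iff.2 fun r hr => hφ r (by omega)) ?_
    (finrank_prefixSpan_le _ _)
  rw [eq_top_iff, ← range_window_comp_blockVec (F := F) (b := c + k) (b' := c + k) (k := k)
    (n := n) (pb := pb) le_rfl (by omega) hn.le]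
  rintro _ ⟨z, rfl⟩
  exact mem_of_gen_pow_mul_mem pb ((window F n k (c + k)).comp (blockVec n (c + k) pb)) hδ
    (S := (prefixSpan F (blockRow n k c pb β') t).map φ)
    (fun r hr => ⟨_, mem_prefixSpan (r := r) (by omega), hφδ r hr⟩) z

/-- Two prefixes for the same block. Reading off the last block and scaling by a nonzero constant
embeds the intersection into the span of `1, α, …, α ^ (t - 1)`, with vanishing first `k`
coordinates. -/
theorem finrank_inf_blockRow_add_le_of_ne_of_le_dim {β' : K}
    (hn : c + k + pb.dim = n) (hkt : k ≤ t) (ht : t ≤ pb.dim) (hβ' : β' ≠ 0) (hne : β' ≠ β) :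
    Module.finrank F ↥(prefixSpan F (blockRow n k c pb β) t ⊓
      prefixSpan F (blockRow n k c pb β') t) + k ≤ t := by
  set y := blockElt n (c + k) pb with hy
  obtain ⟨κ, hκr, hκr'⟩ : ∃ κ : K →ₗ[F] (Fin k → F),
      (∀ r (h : r < k), κ (pb.gen ^ r) = Pi.single ⟨r, h⟩ 1) ∧
      ∀ r, k ≤ r → r < pb.dim → κ (pb.gen ^ r) = 0 := by
    refine ⟨(window F n k (c + k)).comp (blockVec n (c + k) pb), fun r h => ?_, fun r h h' => ?_⟩
    · rw [LinearMap.comp_apply, blockVec_gen_pow (by omega)]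
      exact window_unitVec_self ⟨r, h⟩ (by simp; omega)
    · rw [LinearMap.comp_apply, blockVec_gen_pow h', window_unitVec_eq_zero (by omega)]
  set P := prefixSpan F (fun r => pb.gen ^ r) t with hP
  -- for a nonzero parameter the rows are indexed by the powers of `α`, and the identity block
  -- repeats the first coordinates
  have hA : ∀ γ : K, γ ≠ 0 → ∀ w ∈ prefixSpan F (blockRow n k c pb γ) t,
      γ⁻¹ * y w ∈ P ∧ κ (γ⁻¹ * y w) = window F n k c w := fun γ hγ => by
    have hyr : ∀ r < t, γ⁻¹ * y (blockRow n k c pb γ r) = pb.gen ^ r := fun r hr => by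
      have : y (blockRow n k c pb γ r) = pb.gen ^ r * γ := by
        rcases lt_or_ge r k with h | h
        · rw [blockRow_of_lt_k h, map_add, hy, blockElt_unitVec_of_lt (by omega),
            blockElt_blockVec hn.le, zero_add]
        · rw [blockRow_of_lt_dim h (by omega) hγ, hy, blockElt_blockVec hn.le]
      rw [this, mul_comm, mul_inv_cancel_right₀ hγ]
    have h1 : prefixSpan F (blockRow n k c pb γ) t ≤
        P.comap ((LinearMap.mulLeft F γ⁻¹).comp y) := prefixSpan_le_iff.2 fun r hr => by
      rw [Submodule.mem_comap, LinearMap.comp_apply, LinearMap.mulLeft_apply, hyr r hr]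
      exact mem_prefixSpan (R := fun r => pb.gen ^ r) hr
    have h2 : prefixSpan F (blockRow n k c pb γ) t ≤
        LinearMap.eqLocus (κ.comp ((LinearMap.mulLeft F γ⁻¹).comp y)) (window F n k c) :=
      prefixSpan_le_iff.2 fun r hr => by
        rw [LinearMap.mem_eqLocus, LinearMap.comp_apply, LinearMap.comp_apply,
          LinearMap.mulLeft_apply, hyr r hr]
        rcases lt_or_ge r k with h | h
        · have := window_unitVec_self (F := F) (n := n) (b := c) ⟨r, h⟩ (by simp; omega)
          simp only at this
          rw [hκr r h, blockRow_of_lt_k h, map_add, window_blockVec_eq_zero (by omega), this,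
            add_zero]
        · rw [hκr' r h (by omega), blockRow_of_lt_dim h (by omega) hγ,
            window_blockVec_eq_zero (by omega)]
    exact fun w hw => ⟨h1 hw, h2 hw⟩
  obtain ⟨δ, hδ, hS⟩ : ∃ δ : K, δ ≠ 0 ∧ ∀ w ∈ prefixSpan F (blockRow n k c pb β) t ⊓
      prefixSpan F (blockRow n k c pb β') t, δ * y w ∈ LinearMap.ker κ ⊓ P := by
    by_cases hβ : β = 0
    · refine ⟨1, one_ne_zero, fun w hw => ?_⟩
      rw [one_mul]
      have : prefixSpan F (blockRow n k c pb β) t ≤ (LinearMap.ker κ ⊓ P).comap y := by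
        subst hβ
        refine prefixSpan_le_iff.2 fun r hr => ?_
        rcases lt_or_ge r k with h | h
        · rw [blockRow_zero_of_lt_k h, Submodule.mem_comap, hy, blockElt_unitVec_of_lt (by omega)]
          exact zero_mem _
        · rw [blockRow_zero_of_lt_dim h (by omega), Submodule.mem_comap,
            ← blockVec_gen_pow (pb := pb) (by omega), hy, blockElt_blockVec hn.le]
          exact ⟨hκr' r h (by omega), mem_prefixSpan (R := fun r => pb.gen ^ r) hr⟩
      exact this hw.1
    · refine ⟨β⁻¹ - β'⁻¹, fun h => hne (inv_injective (sub_eq_zero.1 h)).symm, fun w hw => ?_⟩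
      obtain ⟨h1, h2⟩ := hA β hβ w hw.1
      obtain ⟨h3, h4⟩ := hA β' hβ' w hw.2
      rw [sub_mul]
      refine ⟨LinearMap.mem_ker.2 ?_, P.sub_mem h1 h3⟩
      rw [map_sub, h2, h4, sub_self]
  have hfin : Module.finrank F ↥(LinearMap.ker κ ⊓ P) + k ≤ t :=
    finrank_inf_add_le_of_map_eq_top κ le_rfl (eq_top_of_single_mem fun r =>
      ⟨_, mem_prefixSpan (R := fun r => pb.gen ^ r) (r.2.trans_le hkt), hκr r r.2⟩)
      (finrank_prefixSpan_le _ _)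
  have : FiniteDimensional F ↥(LinearMap.ker κ ⊓ P) :=
    Submodule.finiteDimensional_of_le (inf_le_right : LinearMap.ker κ ⊓ P ≤ P)
  let g := ((LinearMap.mulLeft F δ).comp y).restrict hS
  have hg := LinearMap.finrank_le_finrank_of_injective (f := g) <| by
    rw [← LinearMap.ker_eq_bot, LinearMap.ker_eq_bot']
    intro w hw
    have h0 : δ * y w = 0 := congrArg Subtype.val hw
    exact Subtype.ext (eq_zero_of_blockElt_eq_zero hn ht hβ' w.2.2
      ((mul_eq_zero.1 h0).resolve_left hδ))
  omega

/-- `M` against a block, short prefix: `M` only reaches the columns of the last block. -/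
theorem finrank_inf_antiRow_add_le_of_le_dim (hn : c + k + pb.dim = n) (hkt : k ≤ t)
    (ht : t ≤ pb.dim) :
    Module.finrank F ↥(prefixSpan F (antiRow F n) t ⊓
      prefixSpan F (blockRow n k c pb β) t) + k ≤ t :=
  finrank_inf_add_le_of_map_eq_top (window F n k c)
    (prefixSpan_le_iff.2 fun _ hr => window_unitVec_eq_zero (by omega))
    (map_window_prefixSpan_blockRow hn β hkt) (finrank_prefixSpan_le _ _)

/-- `M` against a block, long prefix: `M` contains all columns of the last block. -/
theorem finrank_inf_antiRow_add_le_of_dim_le (hk : k ≤ pb.dim) (hn : c + k + pb.dim = n)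
    (ht : pb.dim ≤ t) (htn : t + k ≤ n) :
    Module.finrank F ↥(prefixSpan F (blockRow n k c pb β) t ⊓
      prefixSpan F (antiRow F n) t) + k ≤ t := by
  obtain ⟨φ, hφ, -, hφr, -⟩ := exists_annihilator hk hn β
  refine finrank_inf_add_le_of_map_eq_top φ (prefixSpan_le_iff.2 fun r hr => hφ r (by omega)) ?_
    (finrank_prefixSpan_le _ _)
  rw [eq_top_iff, ← hφr]
  rintro _ ⟨z, rfl⟩
  refine mem_of_gen_pow_mul_mem pb (φ.comp (blockVec n (c + k) pb)) one_ne_zero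
    (S := (prefixSpan F (antiRow F n) t).map φ)
    (fun r hr => ⟨_, mem_prefixSpan (r := pb.dim - 1 - r) (by omega), ?_⟩) z
  rw [mul_one, LinearMap.comp_apply, blockVec_gen_pow hr, antiRow]
  congr 2
  omega

end Pairs

/-! ### Independence of the rows -/

section Independence

variable {F K : Type*} [Field F] [Field K] [Algebra F K] {n k c t : ℕ} {pb : PowerBasis F K}

/-- If one more vector completes `n - 1` vectors to a spanning family of `F ^ n`, then their
prefixes have the expected dimensions. -/
theorem finrank_prefixSpan_eq {R : ℕ → Fin n → F} (v : Fin n → F)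
    (h : ∀ c < n, unitVec F n c ∈ prefixSpan F R (n - 1) ⊔ Submodule.span F {v})
    (ht : t ≤ n - 1) : Module.finrank F (prefixSpan F R t) = t := by
  have htop : prefixSpan F R (n - 1) ⊔ Submodule.span F {v} = ⊤ := by
    rw [eq_top_iff, ← span_unitVec_eq_top, Submodule.span_le]
    rintro _ ⟨c, rfl⟩
    exact h c c.2
  have hn : n - 1 ≤ Module.finrank F (prefixSpan F R (n - 1)) := by
    have h1 := Submodule.finrank_add_le_finrank_add_finrank (prefixSpan F R (n - 1))
      (Submodule.span F {v})
    have h2 : Module.finrank F (Submodule.span F {v}) ≤ 1 := by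
      simpa using finrank_span_le_card (R := F) ({v} : Set (Fin n → F))
    rw [htop, finrank_top, Module.finrank_fin_fun] at h1
    omega
  have hrange : ∀ m, Set.range (fun r : Fin m => R r) = R '' Set.Iio m := fun m => by
    ext w
    simp only [Set.mem_range, Set.mem_image, Set.mem_Iio]
    exact ⟨fun ⟨r, hr⟩ => ⟨r, r.2, hr⟩, fun ⟨r, hr, h⟩ => ⟨⟨r, hr⟩, h⟩⟩
  have hli : LinearIndependent F fun r : Fin (n - 1) => R r := by
    rw [linearIndependent_iff_card_le_finrank_span, Fintype.card_fin, Set.finrank, hrange]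
    exact hn
  have hli' : LinearIndependent F fun r : Fin t => R r :=
    hli.comp (Fin.castLE ht) (Fin.castLE_injective ht)
  have := finrank_span_eq_card hli'
  rwa [hrange, Fintype.card_fin] at this

theorem finrank_prefixSpan_antiRow (ht : t ≤ n - 1) :
    Module.finrank F (prefixSpan F (antiRow F n) t) = t := by
  refine finrank_prefixSpan_eq (unitVec F n 0) (fun c hc => ?_) ht
  rcases Nat.eq_zero_or_pos c with rfl | h
  · exact Submodule.mem_sup_right (Submodule.mem_span_singleton_self _)
  · refine Submodule.mem_sup_left ?_
    have := mem_prefixSpan (F := F) (R := antiRow F n) (r := n - 1 - c) (t := n - 1) (by omega)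
    rwa [antiRow, show n - 1 - (n - 1 - c) = c by omega] at this

/-- The rows are independent. The vector missing from a spanning family is the row of index `k - 1`
without its entry in the identity block. -/
theorem finrank_prefixSpan_blockRow (hk0 : 0 < k) (hk : k ≤ pb.dim) (hn : c + k + pb.dim = n)
    (β : K) (ht : t ≤ n - 1) :
    Module.finrank F (prefixSpan F (blockRow n k c pb β) t) = t := by
  by_cases hβ : β = 0
  · subst hβ
    refine finrank_prefixSpan_eq (unitVec F n (c + k + (k - 1))) (fun x hx => ?_) ht
    by_cases h1 : x = c + k + (k - 1)
    · subst h1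
      exact Submodule.mem_sup_right (Submodule.mem_span_singleton_self _)
    refine Submodule.mem_sup_left ?_
    have hmem : ∀ r < n - 1, blockRow n k c pb (0 : K) r ∈
      prefixSpan F (blockRow n k c pb (0 : K)) (n - 1) := fun r hr => mem_prefixSpan hr
    rcases lt_or_ge x c with h2 | h2
    · have := hmem (pb.dim + x) (by omega)
      rwa [blockRow_of_dim_le hk (by omega) (by omega), Nat.add_sub_cancel_left] at this
    rcases lt_or_ge x (c + k) with h3 | h3
    · have := hmem (x - c) (by omega)
      rwa [blockRow_zero_of_lt_k (by omega), show c + (x - c) = x by omega] at this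
    rcases lt_or_ge x (c + k + k) with h4 | h4
    · have := hmem (c + pb.dim + (x - (c + k))) (by omega)
      rwa [blockRow_zero_of_le hk (by omega) (by omega),
        show c + k + (c + pb.dim + (x - (c + k)) - (c + pb.dim)) = x by omega] at this
    · have := hmem (x - (c + k)) (by omega)
      rwa [blockRow_zero_of_lt_dim (by omega) (by omega),
        show c + k + (x - (c + k)) = x by omega] at this
  · set v := blockVec n (c + k) pb (pb.gen ^ (k - 1) * β) with hv
    refine finrank_prefixSpan_eq v ?_ ht
    set S := prefixSpan F (blockRow n k c pb β) (n - 1) ⊔ Submodule.span F {v} with hS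
    have hmem : ∀ r < n - 1, blockRow n k c pb β r ∈ S := fun r hr =>
      Submodule.mem_sup_left (mem_prefixSpan hr)
    have hpow : ∀ r < pb.dim, blockVec n (c + k) pb (pb.gen ^ r * β) ∈ S := fun r hr => by
      by_cases h1 : r = k - 1
      · subst h1
        exact Submodule.mem_sup_right (Submodule.mem_span_singleton_self _)
      rcases lt_or_ge r k with h2 | h2
      · have := hmem (c + pb.dim + r) (by omega)
        rwa [blockRow_of_le hk (by omega) hβ, Nat.add_sub_cancel_left] at this
      · have := hmem r (by omega)
        rwa [blockRow_of_lt_dim h2 hr hβ] at this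
    have hall := mem_of_gen_pow_mul_mem pb (blockVec n (c + k) pb) hβ hpow
    intro x hx
    rcases lt_or_ge x c with h2 | h2
    · have := hmem (pb.dim + x) (by omega)
      rwa [blockRow_of_dim_le hk (by omega) (by omega), Nat.add_sub_cancel_left] at this
    rcases lt_or_ge x (c + k) with h3 | h3
    · have := S.sub_mem (hmem (x - c) (by omega)) (hall (pb.gen ^ (x - c) * β))
      rwa [blockRow_of_lt_k (by omega), add_sub_cancel_right, show c + (x - c) = x by omega] at this
    · have := hall (pb.gen ^ (x - (c + k)))
      rwa [blockVec_gen_pow (by omega), show c + k + (x - (c + k)) = x by omega] at this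

end Independence

/-! ### The block generator -/

section BlockGenerator

variable {F : Type*} [Field F] {n : ℕ}

theorem unitVec_eq_single {c : ℕ} (hc : c < n) : unitVec F n c = Pi.single ⟨c, hc⟩ 1 := by
  ext j
  simp [unitVec, Pi.single_apply, Fin.ext_iff]

variable {s k h i : ℕ} {f : F[X]}

/-- The block generator fixes the basis vectors of the first two blocks of columns. -/
theorem unitVec_vecMul_blockGen {c : ℕ} (hc : c < (s - i) * k) :
    Matrix.vecMul (unitVec F (s * k + h) c) (blockGen F s k h i f) = unitVec F (s * k + h) c := by
  have hn : c < s * k + h := by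
    have := Nat.mul_le_mul_right k (Nat.sub_le s i)
    omega
  rw [unitVec_eq_single hn, Matrix.single_one_vecMul]
  ext j
  simp [blockGen, not_le.2 hc, Pi.single_apply, eq_comm, Matrix.row]

theorem unitVec_vecMul_blockGen_pow {c : ℕ} (hc : c < (s - i) * k) (j : ℕ) :
    Matrix.vecMul (unitVec F (s * k + h) c) (blockGen F s k h i f ^ j) =
      unitVec F (s * k + h) c := by
  induction j with
  | zero => simp
  | succ j ih => rw [pow_succ, ← Matrix.vecMul_vecMul, ih, unitVec_vecMul_blockGen hc]

variable [Fact (Irreducible f)]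

theorem gen_pow_natDegree (hf : f.Monic) :
    (AdjoinRoot.root f) ^ f.natDegree =
      - ∑ c ∈ Finset.range f.natDegree, f.coeff c • (AdjoinRoot.root f) ^ c := by
  have h := AdjoinRoot.eval₂_root f
  rw [← AdjoinRoot.algebraMap_eq, ← aeval_def, aeval_eq_sum_range, Finset.sum_range_succ,
    hf.coeff_natDegree, one_smul] at h
  rw [eq_neg_iff_add_eq_zero, add_comm, h]

/-- The block generator acts on the last block of columns as multiplication by the root. -/
theorem blockVec_vecMul_blockGen (hf : f.Monic) (hn : (s - i) * k + f.natDegree = s * k + h)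
    (z : AdjoinRoot f) :
    Matrix.vecMul (blockVec (s * k + h) ((s - i) * k) (AdjoinRoot.powerBasis hf.ne_zero) z)
      (blockGen F s k h i f) =
    blockVec (s * k + h) ((s - i) * k) (AdjoinRoot.powerBasis hf.ne_zero)
      (AdjoinRoot.root f * z) := by
  set pb := AdjoinRoot.powerBasis hf.ne_zero with hpb
  have hdim : pb.dim = f.natDegree := AdjoinRoot.powerBasis_dim _
  have hgen : pb.gen = AdjoinRoot.root f := AdjoinRoot.powerBasis_gen _
  have key : (Matrix.vecMulLinear (blockGen F s k h i f)).comp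
      (blockVec (s * k + h) ((s - i) * k) pb) =
      (blockVec (s * k + h) ((s - i) * k) pb).comp (LinearMap.mulLeft F (AdjoinRoot.root f)) := by
    refine ext_gen_pow (pb := pb) fun r hr => ?_
    have hr' : (s - i) * k + r < s * k + h := by omega
    rw [LinearMap.comp_apply, LinearMap.comp_apply, LinearMap.mulLeft_apply, ← hgen,
      ← pow_succ', blockVec_gen_pow hr, Matrix.vecMulLinear_apply, unitVec_eq_single hr',
      Matrix.single_one_vecMul]
    by_cases h1 : r + 1 < pb.dim
    · rw [blockVec_gen_pow h1]
      ext j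
      have h2 : r + 1 ≠ f.natDegree := by omega
      simp only [blockGen, companionEntry, Matrix.row, Matrix.of_apply, Nat.le_add_right,
        true_and, Nat.add_sub_cancel_left, h2, if_false, unitVec, Fin.ext_iff]
      by_cases h3 : (s - i) * k ≤ (j : ℕ)
      · simp only [h3, if_true]
        congr 1
        simp only [eq_iff_iff]
        omega
      · rw [if_neg h3, if_neg (by omega), if_neg (by omega)]
    · have h2 : r + 1 = f.natDegree := by omega
      rw [h2, hgen, gen_pow_natDegree hf, map_neg, map_sum]
      have : ∀ c ∈ Finset.range f.natDegree,
          blockVec (s * k + h) ((s - i) * k) pb (f.coeff c • AdjoinRoot.root f ^ c) =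
            f.coeff c • unitVec F (s * k + h) ((s - i) * k + c) := fun c hc => by
        rw [map_smul, ← hgen, blockVec_gen_pow (by rw [hdim]; exact Finset.mem_range.1 hc)]
      rw [Finset.sum_congr rfl this]
      ext j
      simp only [blockGen, companionEntry, Matrix.row, Matrix.of_apply, Nat.le_add_right,
        true_and, Nat.add_sub_cancel_left, h2, if_true, unitVec, Fin.ext_iff, Pi.neg_apply,
        Finset.sum_apply, Pi.smul_apply, smul_eq_mul, mul_ite, mul_one, mul_zero]
      by_cases h3 : (s - i) * k ≤ (j : ℕ)
      · rw [if_pos h3, Finset.sum_eq_single ((j : ℕ) - (s - i) * k)]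
        · rw [if_pos (by omega)]
        · intro b _ hb
          exact if_neg (by omega)
        · intro hb
          have := j.2
          exact absurd (Finset.mem_range.2 (by omega)) hb
      · rw [if_neg h3, if_neg (by omega), Finset.sum_eq_zero, neg_zero]
        exact fun c _ => if_neg (by omega)
  exact LinearMap.congr_fun key z

theorem blockVec_vecMul_blockGen_pow (hf : f.Monic)
    (hn : (s - i) * k + f.natDegree = s * k + h) (z : AdjoinRoot f) (j : ℕ) :
    Matrix.vecMul (blockVec (s * k + h) ((s - i) * k) (AdjoinRoot.powerBasis hf.ne_zero) z)
      (blockGen F s k h i f ^ j) =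
    blockVec (s * k + h) ((s - i) * k) (AdjoinRoot.powerBasis hf.ne_zero)
      (AdjoinRoot.root f ^ j * z) := by
  induction j with
  | zero => simp
  | succ j ih =>
    rw [pow_succ, ← Matrix.vecMul_vecMul, ih, blockVec_vecMul_blockGen hf hn, ← mul_assoc,
      ← pow_succ']

theorem blockGen_pow_orderOf (hf : f.Monic) (hn : (s - i) * k + f.natDegree = s * k + h) :
    blockGen F s k h i f ^ orderOf (AdjoinRoot.root f) = 1 := by
  have hdim : (AdjoinRoot.powerBasis hf.ne_zero).dim = f.natDegree := AdjoinRoot.powerBasis_dim _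
  have key : ∀ r : Fin (s * k + h), Matrix.vecMul (unitVec F (s * k + h) r)
      (blockGen F s k h i f ^ orderOf (AdjoinRoot.root f)) = unitVec F (s * k + h) r := fun r => by
    rcases lt_or_ge (r : ℕ) ((s - i) * k) with h1 | h1
    · exact unitVec_vecMul_blockGen_pow h1 _
    · have := r.2
      have hr := blockVec_gen_pow (n := s * k + h) (b := (s - i) * k)
        (pb := AdjoinRoot.powerBasis hf.ne_zero) (r := r - (s - i) * k) (by omega)
      rw [Nat.add_sub_cancel' h1] at hr
      rw [← hr, blockVec_vecMul_blockGen_pow hf hn, pow_orderOf_eq_one, one_mul]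
  ext r c
  have := congrFun (key r) c
  rw [unitVec_eq_single r.2, Matrix.single_one_vecMul] at this
  simpa [Pi.single_apply, Matrix.one_apply, eq_comm, Matrix.row] using this

/-- The group generated by the block generator consists of its powers. -/
theorem exists_mem_groupG_iff (hf : f.Monic) (hn : (s - i) * k + f.natDegree = s * k + h)
    (ho : 0 < orderOf (AdjoinRoot.root f))
    {X : Matrix (Fin (s * k + h)) (Fin (s * k + h)) F} :
    (∃ g ∈ groupG F s k h i f, (g : Matrix (Fin (s * k + h)) (Fin (s * k + h)) F) = X) ↔
      ∃ j : ℕ, blockGen F s k h i f ^ j = X := by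
  have h1 := blockGen_pow_orderOf hf hn
  obtain ⟨u, hu⟩ : IsUnit (blockGen F s k h i f) := IsUnit.of_pow_eq_one h1 ho.ne'
  have hset : {g : GL (Fin (s * k + h)) F |
      (g : Matrix (Fin (s * k + h)) (Fin (s * k + h)) F) = blockGen F s k h i f} = {u} := by
    ext g
    rw [Set.mem_ofPred_eq, Set.mem_singleton_iff, ← hu]
    exact Units.val_inj
  have hfin : IsOfFinOrder u := isOfFinOrder_iff_pow_eq_one.2 ⟨_, ho, by
    ext1
    rw [Units.val_pow_eq_pow_val, hu, h1, Units.val_one]⟩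
  have hG : ∀ g, g ∈ groupG F s k h i f ↔ ∃ j : ℕ, u ^ j = g := fun g => by
    rw [groupG, hset, ← Subgroup.zpowers_eq_closure, ← hfin.mem_powers_iff_mem_zpowers,
      Submonoid.mem_powers_iff]
  constructor
  · rintro ⟨g, hg, rfl⟩
    obtain ⟨j, rfl⟩ := (hG g).1 hg
    exact ⟨j, by rw [Units.val_pow_eq_pow_val, hu]⟩
  · rintro ⟨j, rfl⟩
    exact ⟨u ^ j, (hG _).2 ⟨j, rfl⟩, by rw [Units.val_pow_eq_pow_val, hu]⟩

/-! ### Rows of `A`, `B` and `M` -/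

variable {c : ℕ}

theorem matB_row (hf : f.Monic) (hdeg : f.natDegree = i * k + h)
    (hc : c = (s - i - 1) * k) (hck : c + k = (s - i) * k) (hn : c + f.natDegree = (s - 1) * k + h)
    (hs : (s - 1) * k + k = s * k) (hkd : k ≤ f.natDegree)
    (r : Fin (s * k + h - 1)) :
    matB F s k h i r =
      blockRow (s * k + h) k c (AdjoinRoot.powerBasis hf.ne_zero) (0 : AdjoinRoot f) r := by
  have hdim : (AdjoinRoot.powerBasis hf.ne_zero).dim = f.natDegree := AdjoinRoot.powerBasis_dim _
  have hr := r.2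
  ext j
  simp only [matB, Matrix.of_apply, ← hc, ← hck, ← hn, ← hdeg]
  rcases lt_or_ge (r : ℕ) k with h1 | h1
  · rw [if_pos h1, blockRow_zero_of_lt_k h1]
    rfl
  rw [if_neg (by omega)]
  rcases lt_or_ge (r : ℕ) f.natDegree with h2 | h2
  · rw [if_pos h2, blockRow_zero_of_lt_dim h1 (by omega)]
    rfl
  rw [if_neg (by omega)]
  rcases lt_or_ge (r : ℕ) (c + f.natDegree) with h3 | h3
  · rw [if_pos h3, blockRow_of_dim_le (by omega) (by omega) (by omega), hdim]
    rfl
  rw [if_neg (by omega), blockRow_zero_of_le (by omega) (by omega) (by omega), hdim]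
  rfl

theorem matA_row (hf : f.Monic) (hdeg : f.natDegree = i * k + h)
    (hc : c = (s - i - 1) * k) (hck : c + k = (s - i) * k) (hn : c + f.natDegree = (s - 1) * k + h)
    (hs : (s - 1) * k + k = s * k) (hk0 : 0 < k) (hkd : k ≤ f.natDegree)
    (r : Fin (s * k + h - 1)) :
    matA F s k h i r =
      blockRow (s * k + h) k c (AdjoinRoot.powerBasis hf.ne_zero) (1 : AdjoinRoot f) r := by
  have hdim : (AdjoinRoot.powerBasis hf.ne_zero).dim = f.natDegree := AdjoinRoot.powerBasis_dim _
  have hr := r.2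
  ext j
  simp only [matA, Matrix.of_apply, ← hc, ← hck, ← hn, ← hdeg]
  rcases lt_or_ge (r : ℕ) k with h1 | h1
  · rw [if_pos h1, blockRow_of_lt_k h1, mul_one, blockVec_gen_pow (by omega)]
    simp only [unitVec, Pi.add_apply]
    by_cases h2 : (j : ℕ) = c + r
    · rw [if_pos (Or.inl h2), if_pos h2, if_neg (by omega), add_zero]
    · simp [h2]
  rw [if_neg (by omega)]
  rcases lt_or_ge (r : ℕ) f.natDegree with h2 | h2
  · rw [if_pos h2, blockRow_of_lt_dim h1 (by omega) one_ne_zero, mul_one,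
      blockVec_gen_pow (by omega)]
    rfl
  rw [if_neg (by omega)]
  rcases lt_or_ge (r : ℕ) (c + f.natDegree) with h3 | h3
  · rw [if_pos h3, blockRow_of_dim_le (by omega) (by omega) (by omega), hdim]
    rfl
  rw [if_neg (by omega), blockRow_of_le (by omega) (by omega) one_ne_zero, hdim, mul_one,
    blockVec_gen_pow (by omega)]
  rfl

theorem matA_mul_blockGen_pow_row (hf : f.Monic) (hdeg : f.natDegree = i * k + h)
    (hc : c = (s - i - 1) * k) (hck : c + k = (s - i) * k) (hn : c + f.natDegree = (s - 1) * k + h)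
    (hs : (s - 1) * k + k = s * k) (hk0 : 0 < k) (hkd : k ≤ f.natDegree) (j : ℕ)
    (hj : AdjoinRoot.root f ^ j ≠ 0) (r : Fin (s * k + h - 1)) :
    (matA F s k h i * blockGen F s k h i f ^ j) r =
      blockRow (s * k + h) k c (AdjoinRoot.powerBasis hf.ne_zero) (AdjoinRoot.root f ^ j) r := by
  have hdim : (AdjoinRoot.powerBasis hf.ne_zero).dim = f.natDegree := AdjoinRoot.powerBasis_dim _
  have hn' : (s - i) * k + f.natDegree = s * k + h := by omega
  have hT := fun z => blockVec_vecMul_blockGen_pow hf hn' z j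
  simp only [mul_comm (AdjoinRoot.root f ^ j)] at hT
  rw [Matrix.mul_apply_eq_vecMul, matA_row hf hdeg hc hck hn hs hk0 hkd]
  rcases lt_or_ge (r : ℕ) k with h1 | h1
  · rw [blockRow_of_lt_k h1, blockRow_of_lt_k h1, Matrix.add_vecMul,
      unitVec_vecMul_blockGen_pow (by omega), hck, hT, mul_one]
  rcases lt_or_ge (r : ℕ) f.natDegree with h2 | h2
  · rw [blockRow_of_lt_dim h1 (by omega) one_ne_zero, blockRow_of_lt_dim h1 (by omega) hj,
      hck, hT, mul_one]
  rcases lt_or_ge (r : ℕ) (c + f.natDegree) with h3 | h3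
  · rw [blockRow_of_dim_le (by omega) (by omega) (by omega),
      blockRow_of_dim_le (by omega) (by omega) (by omega),
      unitVec_vecMul_blockGen_pow (by omega)]
  · rw [blockRow_of_le (by omega) (by omega) one_ne_zero, blockRow_of_le (by omega) (by omega) hj,
      hck, hT, mul_one]

end BlockGenerator

theorem matM_row {F : Type*} [Field F] {s k h : ℕ} (r : Fin (s * k + h - 1)) : matM F s k h r = antiRow F (s * k + h) r := by
  ext j
  have := r.2
  have := j.2
  simp only [matM, antiRow, unitVec, Matrix.of_apply]
  congr 1
  simp only [eq_iff_iff]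
  omega

/-- The powers of a primitive root are all nonzero elements of the field. -/
theorem exists_root_pow_eq {F : Type*} [Field F] [Fintype F] {f : F[X]} [Fact (Irreducible f)]
    (hf : IsPrimitivePolynomial f) {z : AdjoinRoot f} (hz : z ≠ 0) :
    ∃ j : ℕ, AdjoinRoot.root f ^ j = z := by
  obtain ⟨hm, -, ho⟩ := hf
  have : Module.Finite F (AdjoinRoot f) := (AdjoinRoot.powerBasis hm.ne_zero).finite
  have : Finite (AdjoinRoot f) := Module.finite_of_finite F
  have hcard : Nat.card (AdjoinRoot f) = Nat.card F ^ f.natDegree := by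
    rw [Module.natCard_eq_pow_finrank (K := F), (AdjoinRoot.powerBasis hm.ne_zero).finrank,
      AdjoinRoot.powerBasis_dim]
  have hcardu : Nat.card (AdjoinRoot f)ˣ = orderOf (AdjoinRoot.root f) := by
    rw [Nat.card_units, hcard, ho]
  have h0 : AdjoinRoot.root f ≠ 0 := fun h => by
    have : 0 < Nat.card (AdjoinRoot f)ˣ := Nat.card_pos
    rw [hcardu, h, orderOf_zero] at this
    exact lt_irrefl _ this
  have htop : Subgroup.zpowers (Units.mk0 _ h0) = ⊤ := by
    apply Subgroup.eq_top_of_card_eq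
    rw [Nat.card_zpowers, hcardu, ← orderOf_units, Units.val_mk0]
  have hz' : Units.mk0 z hz ∈ Subgroup.zpowers (Units.mk0 _ h0) := htop ▸ Subgroup.mem_top _
  rw [← (isOfFinOrder_of_finite _).mem_powers_iff_mem_zpowers, Submonoid.mem_powers_iff] at hz'
  obtain ⟨j, hj⟩ := hz'
  exact ⟨j, by simpa using congrArg Units.val hj⟩

/-! ### The family of generator rows -/

section Family

variable {F : Type*} [Field F] {s k h : ℕ} {K : Fin (s - 1) → Type*}
  [∀ i, Field (K i)] [∀ i, Algebra F (K i)]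

/-- The rows of all generator matrices, indexed by one point for `M` and by the disjoint union of
the fields `K i`; the field with index `i` belongs to the block of dimension `(i + 1) * k + h`. -/
noncomputable def codeRow (s k h : ℕ) {K : Fin (s - 1) → Type*} [∀ i, Field (K i)]
    [∀ i, Algebra F (K i)] (pb : ∀ i, PowerBasis F (K i)) :
    Option (Σ i, K i) → ℕ → Fin (s * k + h) → F
  | none => antiRow F (s * k + h)
  | some x => blockRow (s * k + h) k ((s - (x.1 + 1) - 1) * k) (pb x.1) x.2

variable {pb : ∀ i, PowerBasis F (K i)}

theorem codeRow_none : codeRow s k h pb none = antiRow F (s * k + h) := rfl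

theorem codeRow_some (i : Fin (s - 1)) (β : K i) : codeRow s k h pb (some ⟨i, β⟩) =
    blockRow (s * k + h) k ((s - (i + 1) - 1) * k) (pb i) β := rfl

/-- The dimensions `k, …, k + h` and `m * k + h` with `2 ≤ m ≤ s - 1`, at which two different
prefixes meet in codimension `k`. The bounds at the remaining entries of the type follow from those
at `k` and at `n - k = (s - 1) * k + h` by monotonicity. -/
def IsCentralDim (s k h t : ℕ) : Prop :=
  k ≤ t ∧ t ≤ k + h ∨ ∃ m, 2 ≤ m ∧ m ≤ s - 1 ∧ t = m * k + h

/-- The three blocks of columns fill up all `s * k + h` columns. -/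
theorem block_columns (i : Fin (s - 1)) :
    (s - (i + 1) - 1) * k + k + ((i + 1) * k + h) = s * k + h := by
  have hi := i.2
  have : s = (s - (i + 1) - 1) + 1 + (i + 1) := by omega
  conv_rhs => rw [this]
  ring

/-- Different blocks. Writing `t = m * k + h`, the argument depends on the position of `m` relative
to the block indices `i + 1 < i' + 1`. -/
theorem finrank_inf_codeRow_add_le_of_lt (hs4 : s ≠ 4)
    (hpb : ∀ i : Fin (s - 1), (pb i).dim = (i + 1) * k + h) {t : ℕ} (ht : IsCentralDim s k h t)
    {i i' : Fin (s - 1)} (hii : (i : ℕ) < i') (β : K i) (β' : K i') :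
    Module.finrank F ↥(prefixSpan F (codeRow s k h pb (some ⟨i, β⟩)) t ⊓
      prefixSpan F (codeRow s k h pb (some ⟨i', β'⟩)) t) + k ≤ t := by
  have hi' := i'.2
  have hn : (s - (i + 1) - 1) * k + k + (pb i).dim = s * k + h := by
    rw [hpb]; exact block_columns i
  have hn' : (s - (i' + 1) - 1) * k + k + (pb i').dim = s * k + h := by
    rw [hpb]; exact block_columns i'
  have hk : k ≤ (pb i).dim := by
    rw [hpb, add_mul, one_mul]; omega
  have hc : (s - (i' + 1) - 1) * k + k ≤ (s - (i + 1) - 1) * k := by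
    rw [← Nat.succ_mul]
    exact Nat.mul_le_mul_right k (by omega)
  rw [codeRow_some, codeRow_some]
  rcases ht with ⟨hkt, ht⟩ | ⟨m, hm2, hms, rfl⟩
  · refine finrank_inf_blockRow_add_le_of_le_dim hn' hc hkt ?_
    rw [hpb, add_mul, one_mul]; omega
  have hmul : ∀ {a b : ℕ}, a ≤ b → a * k ≤ b * k := fun hab => Nat.mul_le_mul_right k hab
  have hmn : m * k + h + k ≤ s * k + h := by
    have := hmul (show m + 1 ≤ s by omega)
    rw [add_mul] at this; omega
  rcases Nat.lt_or_ge (i + 1) m with him | him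
  · have hdt : (pb i).dim + k ≤ m * k + h := by
      have := hmul (show (i + 1) + 1 ≤ m by omega)
      rw [add_mul] at this; rw [hpb]; omega
    rcases Nat.lt_or_ge m (i' + 1) with him' | him'
    · have htd' : m * k + h ≤ (pb i').dim := by
        have := hmul him'.le
        rw [hpb]; omega
      by_cases hβ' : β' = 0
      · by_cases hlast : (i' : ℕ) + 1 = s - 1
        · subst hβ'
          have hc0 : (s - (i' + 1) - 1) * k = 0 := by
            rw [show s - (i' + 1) - 1 = 0 by omega, zero_mul]
          rw [hc0] at hn' ⊢
          refine finrank_inf_blockRow_add_le_of_eq_zero hk hn (by omega) hdt htd' ?_ ?_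
          · have := hmul (show m + 1 + 1 ≤ s by omega)
            rw [add_mul, add_mul] at this; omega
          · rcases Nat.lt_or_ge (i + 1 + 3) s with h3 | h3
            · exact Or.inl (hmul (by omega))
            · refine Or.inr ⟨by rw [show s - (i + 1) - 1 = 2 by omega], ?_⟩
              have := hmul (show 2 ≤ (i : ℕ) + 1 by omega)
              rw [hpb]; omega
        · refine finrank_inf_blockRow_add_le_of_k_le hk hn hdt htd' hmn ?_
          have := hmul (show 1 ≤ s - (i' + 1) - 1 by omega)
          omega
      · exact finrank_inf_blockRow_add_le_of_ne_zero hk hn hn' hdt htd' hmn hβ'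
    · refine finrank_inf_blockRow_add_le_of_dim_le hk hn hn' hc ?_ hmn
      have := hmul him'
      rw [hpb]; omega
  · refine finrank_inf_blockRow_add_le_of_le_dim hn' hc ?_ ?_
    · have := hmul hm2
      omega
    · have := hmul him
      rw [hpb]; omega

theorem finrank_inf_codeRow_none_add_le (hpb : ∀ i : Fin (s - 1), (pb i).dim = (i + 1) * k + h)
    {t : ℕ} (ht : IsCentralDim s k h t)
    (x : Σ i, K i) :
    Module.finrank F ↥(prefixSpan F (codeRow s k h pb (some x)) t ⊓
      prefixSpan F (codeRow s k h pb none) t) + k ≤ t := by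
  obtain ⟨i, β⟩ := x
  have hi := i.2
  have hn : (s - (i + 1) - 1) * k + k + (pb i).dim = s * k + h := by
    rw [hpb]; exact block_columns i
  have hk : k ≤ (pb i).dim := by
    rw [hpb, add_mul, one_mul]; omega
  have hmul : ∀ {a b : ℕ}, a ≤ b → a * k ≤ b * k := fun hab => Nat.mul_le_mul_right k hab
  rw [codeRow_some, codeRow_none]
  rcases ht with ⟨hkt, ht⟩ | ⟨m, hm2, hms, rfl⟩
  · rw [inf_comm]
    refine finrank_inf_antiRow_add_le_of_le_dim hn hkt ?_
    rw [hpb, add_mul, one_mul]; omega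
  rcases Nat.lt_or_ge (i + 1) m with him | him
  · refine finrank_inf_antiRow_add_le_of_dim_le hk hn ?_ ?_
    · have := hmul him.le
      rw [hpb]; omega
    · have := hmul (show m + 1 ≤ s by omega)
      rw [add_mul] at this; omega
  · rw [inf_comm]
    refine finrank_inf_antiRow_add_le_of_le_dim hn ?_ ?_
    · have := hmul hm2
      omega
    · have := hmul him
      rw [hpb]; omega

theorem finrank_inf_codeRow_add_le_of_ne_zero
    (hpb : ∀ i : Fin (s - 1), (pb i).dim = (i + 1) * k + h) {t : ℕ} (ht : IsCentralDim s k h t)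
    {i : Fin (s - 1)} {β β' : K i} (hβ' : β' ≠ 0) (hne : β' ≠ β) :
    Module.finrank F ↥(prefixSpan F (codeRow s k h pb (some ⟨i, β⟩)) t ⊓
      prefixSpan F (codeRow s k h pb (some ⟨i, β'⟩)) t) + k ≤ t := by
  have hi := i.2
  have hn : (s - (i + 1) - 1) * k + k + (pb i).dim = s * k + h := by
    rw [hpb]; exact block_columns i
  have hk : k ≤ (pb i).dim := by
    rw [hpb, add_mul, one_mul]; omega
  have hmul : ∀ {a b : ℕ}, a ≤ b → a * k ≤ b * k := fun hab => Nat.mul_le_mul_right k hab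
  rw [codeRow_some, codeRow_some]
  rcases ht with ⟨hkt, ht⟩ | ⟨m, hm2, hms, rfl⟩
  · refine finrank_inf_blockRow_add_le_of_ne_of_le_dim hn hkt ?_ hβ' hne
    rw [hpb, add_mul, one_mul]; omega
  rcases Nat.lt_or_ge (i + 1) m with him | him
  · refine finrank_inf_blockRow_add_le_of_ne_of_dim_le hk hn ?_ ?_ hβ' hne
    · have := hmul him.le
      rw [hpb]; omega
    · have := hmul (show m + 1 ≤ s by omega)
      rw [add_mul] at this; omega
  · refine finrank_inf_blockRow_add_le_of_ne_of_le_dim hn ?_ ?_ hβ' hne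
    · have := hmul hm2
      omega
    · have := hmul him
      rw [hpb]; omega

/-- The prefixes of two different generator matrices meet in codimension at least `k`. -/
theorem finrank_inf_codeRow_add_le (hs4 : s ≠ 4)
    (hpb : ∀ i : Fin (s - 1), (pb i).dim = (i + 1) * k + h) {t : ℕ} (ht : IsCentralDim s k h t)
    {x y : Option (Σ i, K i)} (hxy : x ≠ y) :
    Module.finrank F ↥(prefixSpan F (codeRow s k h pb x) t ⊓
      prefixSpan F (codeRow s k h pb y) t) + k ≤ t := by
  rcases x with _ | ⟨i, β⟩ <;> rcases y with _ | ⟨i', β'⟩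
  · exact absurd rfl hxy
  · rw [inf_comm]
    exact finrank_inf_codeRow_none_add_le hpb ht _
  · exact finrank_inf_codeRow_none_add_le hpb ht _
  · rcases lt_trichotomy i i' with h1 | rfl | h1
    · exact finrank_inf_codeRow_add_le_of_lt hs4 hpb ht h1 β β'
    · have hne : β ≠ β' := fun h => hxy (by rw [h])
      by_cases hβ' : β' = 0
      · rw [inf_comm]
        exact finrank_inf_codeRow_add_le_of_ne_zero hpb ht (hβ' ▸ hne) hne
      · exact finrank_inf_codeRow_add_le_of_ne_zero hpb ht hβ' hne.symm
    · rw [inf_comm]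
      exact finrank_inf_codeRow_add_le_of_lt hs4 hpb ht h1 β' β

theorem finrank_prefixSpan_codeRow (hpb : ∀ i : Fin (s - 1), (pb i).dim = (i + 1) * k + h)
    (hhk : h < k) {t : ℕ} (ht : t ≤ s * k + h - 1) (x : Option (Σ i, K i)) :
    Module.finrank F (prefixSpan F (codeRow s k h pb x) t) = t := by
  rcases x with _ | ⟨i, β⟩
  · exact finrank_prefixSpan_antiRow ht
  · refine finrank_prefixSpan_blockRow (by omega) ?_ ?_ β ht
    · rw [hpb, add_mul, one_mul]; omega
    · rw [hpb]; exact block_columns i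

/-! ### Distances -/

/-- The subspace distance in terms of the intersection, with the bounds that make the natural
subtractions exact. -/
theorem subspaceDist_prefixSpan_codeRow
    (hpb : ∀ i : Fin (s - 1), (pb i).dim = (i + 1) * k + h)
    (hhk : h < k) {t : ℕ} (ht : t ≤ s * k + h - 1) (x y : Option (Σ i, K i)) :
    Module.finrank F ↥(prefixSpan F (codeRow s k h pb x) t ⊓
        prefixSpan F (codeRow s k h pb y) t) ≤ t ∧
      2 * t ≤ Module.finrank F ↥(prefixSpan F (codeRow s k h pb x) t ⊓
        prefixSpan F (codeRow s k h pb y) t) + (s * k + h) ∧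
      subspaceDist (prefixSpan F (codeRow s k h pb x) t) (prefixSpan F (codeRow s k h pb y) t) =
      2 * (t - Module.finrank F ↥(prefixSpan F (codeRow s k h pb x) t ⊓
        prefixSpan F (codeRow s k h pb y) t)) := by
  have h1 := Submodule.finrank_sup_add_finrank_inf_eq
    (prefixSpan F (codeRow s k h pb x) t) (prefixSpan F (codeRow s k h pb y) t)
  have hx := finrank_prefixSpan_codeRow hpb hhk ht x
  have hy := finrank_prefixSpan_codeRow hpb hhk ht y
  have h2 := Submodule.finrank_mono (inf_le_left :
    prefixSpan F (codeRow s k h pb x) t ⊓ prefixSpan F (codeRow s k h pb y) t ≤ _)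
  have h3 := Submodule.finrank_le
    (prefixSpan F (codeRow s k h pb x) t ⊔ prefixSpan F (codeRow s k h pb y) t)
  rw [Module.finrank_fin_fun] at h3
  rw [hx] at h1 h2
  rw [hy] at h1
  refine ⟨h2, by omega, ?_⟩
  rw [subspaceDist]
  omega

/-- The subspace distance at every entry of the type. Below `k` the intersections vanish because
they do at `k`; from `n - k` on the sums are everything because they are at `n - k`. -/
theorem le_subspaceDist_codeRow (hs : 3 ≤ s) (hs4 : s ≠ 4)
    (hpb : ∀ i : Fin (s - 1), (pb i).dim = (i + 1) * k + h)
    (hhk : h < k) {t : ℕ} (ht : t ≤ s * k + h - 1)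
    (ht' : t < k ∨ IsCentralDim s k h t ∨ s * k + h ≤ t + k)
    {x y : Option (Σ i, K i)} (hxy : x ≠ y) :
    2 * min (min t k) (s * k + h - t) ≤
      subspaceDist (prefixSpan F (codeRow s k h pb x) t) (prefixSpan F (codeRow s k h pb y) t) := by
  obtain ⟨h1, -, h2⟩ := subspaceDist_prefixSpan_codeRow hpb hhk ht x y
  have hsk : 3 * k ≤ s * k := Nat.mul_le_mul_right k hs
  rcases ht' with ht' | ht' | ht'
  · have h3 := finrank_inf_codeRow_add_le (F := F) (pb := pb) hs4 hpb
      (t := k) (Or.inl ⟨le_rfl, by omega⟩) hxy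
    have h4 := Submodule.finrank_mono (inf_le_inf
      (prefixSpan_mono (F := F) (codeRow s k h pb x) ht'.le)
      (prefixSpan_mono (F := F) (codeRow s k h pb y) ht'.le))
    omega
  · have h3 := finrank_inf_codeRow_add_le (F := F) (pb := pb) hs4 hpb ht' hxy
    omega
  · have hn : (s - 1) * k + k = s * k := by
      rw [← Nat.succ_mul]; congr 1; omega
    have hle : (s - 1) * k + h ≤ t := by omega
    have h3 := finrank_inf_codeRow_add_le (F := F) (pb := pb) hs4 hpb
      (t := (s - 1) * k + h) (Or.inr ⟨s - 1, by omega, le_rfl, rfl⟩) hxy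
    have h4 := Submodule.finrank_mono (sup_le_sup
      (prefixSpan_mono (F := F) (codeRow s k h pb x) hle)
      (prefixSpan_mono (F := F) (codeRow s k h pb y) hle))
    have h5 := Submodule.finrank_sup_add_finrank_inf_eq
      (prefixSpan F (codeRow s k h pb x) t) (prefixSpan F (codeRow s k h pb y) t)
    have h6 := Submodule.finrank_sup_add_finrank_inf_eq
      (prefixSpan F (codeRow s k h pb x) ((s - 1) * k + h))
      (prefixSpan F (codeRow s k h pb y) ((s - 1) * k + h))
    rw [finrank_prefixSpan_codeRow hpb hhk ht, finrank_prefixSpan_codeRow hpb hhk ht] at h5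
    rw [finrank_prefixSpan_codeRow hpb hhk (by omega),
      finrank_prefixSpan_codeRow hpb hhk (by omega)] at h6
    omega

/-- For the largest block, the matrices `A` and `B` share the rows of index `k` to `n - k - 1`, so
their distance is as small as the lower bound permits. -/
theorem subspaceDist_codeRow_last_le (hs : 3 ≤ s)
    (hpb : ∀ i : Fin (s - 1), (pb i).dim = (i + 1) * k + h)
    (hhk : h < k) {t : ℕ} (ht : t ≤ s * k + h - 1) {i : Fin (s - 1)} (hi : (i : ℕ) + 1 = s - 1) :
    subspaceDist (prefixSpan F (codeRow s k h pb (some ⟨i, 1⟩)) t)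
      (prefixSpan F (codeRow s k h pb (some ⟨i, 0⟩)) t) ≤
      2 * min (min t k) (s * k + h - t) := by
  obtain ⟨h1, h1', h2⟩ := subspaceDist_prefixSpan_codeRow hpb hhk ht (some ⟨i, 1⟩) (some ⟨i, 0⟩)
  have hn := block_columns (k := k) (h := h) i
  rw [← hpb] at hn
  have hc : (s - (i + 1) - 1) * k = 0 := by
    rw [show s - (i + 1) - 1 = 0 by omega, zero_mul]
  rw [hc] at hn
  -- the shared rows are the unit vectors in the columns `2 * k, …, k + t - 1`
  have hshare : ∀ m, m ≤ (pb i).dim → m ≤ t → k ≤ m → m - k ≤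
      Module.finrank F ↥(prefixSpan F (codeRow s k h pb (some ⟨i, 1⟩)) t ⊓
        prefixSpan F (codeRow s k h pb (some ⟨i, 0⟩)) t) := fun m hm hmt hkm => by
    have hle : prefixSpan F (fun r => unitVec F (s * k + h) (k + k + r)) (m - k) ≤
        prefixSpan F (codeRow s k h pb (some ⟨i, 1⟩)) t ⊓
          prefixSpan F (codeRow s k h pb (some ⟨i, 0⟩)) t := by
      refine prefixSpan_le_iff.2 fun r hr => ⟨?_, ?_⟩
      · have := mem_prefixSpan (F := F) (R := codeRow s k h pb (some ⟨i, 1⟩)) (r := k + r) (t := t)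
          (by omega)
        rw [codeRow_some, hc] at this ⊢
        rwa [blockRow_of_lt_dim (by omega) (by omega) one_ne_zero, mul_one,
          blockVec_gen_pow (by omega), show 0 + k + (k + r) = k + k + r by omega] at this
      · have := mem_prefixSpan (F := F) (R := codeRow s k h pb (some ⟨i, 0⟩)) (r := k + r) (t := t)
          (by omega)
        rw [codeRow_some, hc] at this ⊢
        rwa [blockRow_zero_of_lt_dim (by omega) (by omega),
          show 0 + k + (k + r) = k + k + r by omega] at this
    have hfin : m - k ≤ Module.finrank F
        (prefixSpan F (fun r => unitVec F (s * k + h) (k + k + r)) (m - k)) := by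
      have hmap : (prefixSpan F (fun r => unitVec F (s * k + h) (k + k + r)) (m - k)).map
          (window F (s * k + h) (m - k) (k + k)) = ⊤ :=
        eq_top_of_single_mem fun r => ⟨_,
          mem_prefixSpan (R := fun r => unitVec F (s * k + h) (k + k + r)) r.2,
          window_unitVec_self r (by omega)⟩
      have := Submodule.finrank_map_le (window F (s * k + h) (m - k) (k + k))
        (prefixSpan F (fun r => unitVec F (s * k + h) (k + k + r)) (m - k))
      rwa [hmap, finrank_top, Module.finrank_fin_fun] at this
    exact hfin.trans (Submodule.finrank_mono hle)
  rcases Nat.lt_or_ge t k with h3 | h3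
  · omega
  · rcases Nat.lt_or_ge (pb i).dim t with h4 | h4
    -- past `n - k` the bound `2 * t ≤ dim (U ∩ U') + n` already suffices
    · omega
    · have := hshare t h4 le_rfl h3
      omega

end Family

/-! ### The type vector -/

/-- Every term is at most `2 * k`; the first and the last `k` entries of the type pair up to
`2 * (k + 1)`, and each of the other `h + (s - 3)` entries contributes `2 * k`. -/
theorem sum_min_longType {s k h : ℕ} (hs : 3 ≤ s) (hhk : h < k) :
    ∑ j, 2 * min (min (longType s k h j) k) (s * k + h - longType s k h j) =
      2 * k * (s + h + k - 2) := by
  set T : ℕ → ℕ := fun j =>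
    if j < k + h then j + 1
    else if j < (k + h) + (s - 3) then (j - (k + h) + 2) * k + h
    else (s - 1) * k + h + (j - ((k + h) + (s - 3))) with hT
  have h1 : ∑ j, 2 * min (min (longType s k h j) k) (s * k + h - longType s k h j) =
      ∑ j ∈ Finset.range (k + h + (s - 3) + k), 2 * min (min (T j) k) (s * k + h - T j) :=
    Fin.sum_univ_eq_sum_range (fun j => 2 * min (min (T j) k) (s * k + h - T j)) _
  have hsk : 3 * k ≤ s * k := Nat.mul_le_mul_right k hs
  have hn : (s - 1) * k + k = s * k := by
    rw [← Nat.succ_mul]; congr 1; omega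
  rw [h1, Finset.sum_range_add, Finset.sum_range_add, Finset.sum_range_add]
  have e1 : ∀ j ∈ Finset.range k, 2 * min (min (T j) k) (s * k + h - T j) = 2 * (j + 1) :=
    fun j hj => by
    have hj := Finset.mem_range.1 hj
    simp only [hT]
    rw [if_pos (by omega)]
    omega
  have e2 : ∀ j ∈ Finset.range h, 2 * min (min (T (k + j)) k) (s * k + h - T (k + j)) = 2 * k :=
    fun j hj => by
    have hj := Finset.mem_range.1 hj
    simp only [hT]
    rw [if_pos (by omega)]
    omega
  have e3 : ∀ j ∈ Finset.range (s - 3),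
      2 * min (min (T (k + h + j)) k) (s * k + h - T (k + h + j)) = 2 * k := fun j hj => by
    have hj := Finset.mem_range.1 hj
    simp only [hT]
    rw [if_neg (by omega), if_pos (by omega), Nat.add_sub_cancel_left]
    have h2 : (j + 2 + 1) * k ≤ s * k := Nat.mul_le_mul_right k (by omega)
    have h3 : 1 * k ≤ (j + 2) * k := Nat.mul_le_mul_right k (by omega)
    rw [add_mul] at h2
    omega
  have e4 : ∀ j ∈ Finset.range k, 2 * min (min (T (k + h + (s - 3) + j)) k)
      (s * k + h - T (k + h + (s - 3) + j)) = 2 * (k - j) := fun j hj => by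
    have hj := Finset.mem_range.1 hj
    simp only [hT]
    rw [if_neg (by omega), if_neg (by omega), Nat.add_sub_cancel_left]
    omega
  rw [Finset.sum_congr rfl e1, Finset.sum_congr rfl e2, Finset.sum_congr rfl e3,
    Finset.sum_congr rfl e4]
  have e5 : ∑ j ∈ Finset.range k, 2 * (j + 1) + ∑ j ∈ Finset.range k, 2 * (k - j) =
      k * (2 * (k + 1)) := by
    rw [← Finset.sum_add_distrib, Finset.sum_congr rfl (g := fun _ => 2 * (k + 1)), Finset.sum_const,
      Finset.card_range, smul_eq_mul]
    intro j hj
    have hj := Finset.mem_range.1 hj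
    omega
  rw [Finset.sum_const, Finset.sum_const, Finset.card_range, Finset.card_range, smul_eq_mul,
    smul_eq_mul]
  obtain ⟨u, rfl⟩ : ∃ u, s = u + 3 := ⟨s - 3, by omega⟩
  rw [show u + 3 + h + k - 2 = u + h + k + 1 by omega, Nat.add_sub_cancel]
  linear_combination e5

theorem longType_spec {s k h : ℕ} (hs : 3 ≤ s) (hhk : h < k)
    (j : Fin ((k + h) + (s - 3) + k)) :
    1 ≤ longType s k h j ∧ longType s k h j ≤ s * k + h - 1 ∧
      (longType s k h j < k ∨ IsCentralDim s k h (longType s k h j) ∨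
        s * k + h ≤ longType s k h j + k) := by
  have hj := j.2
  have hsk : 3 * k ≤ s * k := Nat.mul_le_mul_right k hs
  have hn : (s - 1) * k + k = s * k := by
    rw [← Nat.succ_mul]; congr 1; omega
  simp only [longType]
  split_ifs with h1 h2
  · refine ⟨by omega, by omega, ?_⟩
    rcases Nat.lt_or_ge (j + 1) k with h3 | h3
    · exact Or.inl h3
    · exact Or.inr (Or.inl (Or.inl ⟨h3, h1⟩))
  · have h2 : ((j : ℕ) - (k + h) + 2 + 1) * k ≤ s * k := Nat.mul_le_mul_right k (by omega)
    have h3 : 1 * k ≤ ((j : ℕ) - (k + h) + 2) * k := Nat.mul_le_mul_right k (by omega)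
    rw [add_mul] at h2
    exact ⟨by omega, by omega, Or.inr (Or.inl (Or.inr ⟨_, by omega, by omega, rfl⟩))⟩
  · exact ⟨by omega, by omega, Or.inr (Or.inr (by omega))⟩

theorem strictMono_longType {s k h : ℕ} (hs : 3 ≤ s) (hhk : h < k) :
    StrictMono (longType s k h) := by
  intro a b hab
  have hab : (a : ℕ) < b := hab
  have hb := b.2
  have hmul : ∀ {x y : ℕ}, x ≤ y → x * k ≤ y * k := fun h => Nat.mul_le_mul_right k h
  simp only [longType]
  split_ifs with h1 h2 h3 h4 h5
  · omega
  · have := hmul (show 2 ≤ (b : ℕ) - (k + h) + 2 by omega)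
    omega
  · have := hmul (show 2 ≤ s - 1 by omega)
    omega
  · omega
  · have := hmul (show (a : ℕ) - (k + h) + 2 + 1 ≤ (b : ℕ) - (k + h) + 2 by omega)
    rw [add_mul _ 1] at this
    omega
  · have := hmul (show (a : ℕ) - (k + h) + 2 + 1 ≤ s - 1 by omega)
    rw [add_mul _ 1] at this
    omega
  all_goals omega

/-! ### The codes as injective families -/

section Codes

theorem rowSpaceFirst_of {F : Type*} [Field F] {m n t : ℕ} (R : ℕ → Fin n → F) (ht : t ≤ m) :
    rowSpaceFirst (Matrix.of fun r : Fin m => R r) t = prefixSpan F R t := by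
  rw [rowSpaceFirst, prefixSpan]
  congr 1
  ext v
  constructor
  · rintro ⟨r, hr, rfl⟩
    exact ⟨r, hr, rfl⟩
  · rintro ⟨r, hr, rfl⟩
    exact ⟨⟨r, lt_of_lt_of_le hr ht⟩, hr, rfl⟩

theorem rowSpace_of {F : Type*} [Field F] {m n : ℕ} (R : ℕ → Fin n → F) :
    rowSpace (Matrix.of fun r : Fin m => R r) = prefixSpan F R m := by
  rw [← rowSpaceFirst_of R le_rfl, rowSpace, rowSpaceFirst]
  congr 1
  ext v
  constructor
  · rintro ⟨r, rfl⟩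
    exact ⟨r, r.2, rfl⟩
  · rintro ⟨r, -, rfl⟩
    exact ⟨r, rfl⟩

variable {F : Type*} [Field F] [Fintype F] {s k h : ℕ} {f : ℕ → F[X]}

/-- Since `α` is primitive, its powers are all nonzero elements of the field, so the matrices
`A g` and `B` of one block are indexed by that field. -/
theorem generatorMatrices_eq_range [∀ i : Fin (s - 1), Fact (Irreducible (f (i + 1)))]
    (hhk : h < k)
    (hf : ∀ i : Fin (s - 1), IsPrimitivePolynomial (f (i + 1)) ∧
      (f (i + 1)).natDegree = (i + 1) * k + h) (hs : 1 ≤ s) :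
    generatorMatrices s k h f = Set.range fun x => Matrix.of fun r : Fin (s * k + h - 1) =>
      codeRow s k h (fun i : Fin (s - 1) => AdjoinRoot.powerBasis (hf i).1.1.ne_zero) x r := by
  have hsk : (s - 1) * k + k = s * k := by
    rw [← Nat.succ_mul]; congr 1; omega
  have hblock : ∀ i : Fin (s - 1),
      (s - (i + 1) - 1) * k + k = (s - (i + 1)) * k ∧
      (s - (i + 1) - 1) * k + (f (i + 1)).natDegree = (s - 1) * k + h ∧
      k ≤ (f (i + 1)).natDegree := fun i => by
    have hi := i.2
    have h1 := block_columns (k := k) (h := h) i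
    have h2 : (s - (i + 1) - 1) * k + k = (s - (i + 1)) * k := by
      rw [← Nat.succ_mul]; congr 1; omega
    refine ⟨h2, ?_, ?_⟩
    · rw [(hf i).2]; omega
    · rw [(hf i).2, add_mul, one_mul]; omega
  have hB : ∀ i : Fin (s - 1), matB F s k h (i + 1) = Matrix.of fun r : Fin (s * k + h - 1) =>
      codeRow s k h (fun i : Fin (s - 1) => AdjoinRoot.powerBasis (hf i).1.1.ne_zero)
        (some ⟨i, 0⟩) r := fun i => by
    obtain ⟨h1, h2, h3⟩ := hblock i
    exact funext fun r => matB_row (hf i).1.1 (hf i).2 rfl h1 h2 hsk h3 r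
  have hA : ∀ (i : Fin (s - 1)) (j : ℕ), AdjoinRoot.root (f (i + 1)) ^ j ≠ 0 →
      matA F s k h (i + 1) * blockGen F s k h (i + 1) (f (i + 1)) ^ j =
      Matrix.of fun r : Fin (s * k + h - 1) =>
      codeRow s k h (fun i : Fin (s - 1) => AdjoinRoot.powerBasis (hf i).1.1.ne_zero)
        (some ⟨i, AdjoinRoot.root (f (i + 1)) ^ j⟩) r := fun i j hj => by
    obtain ⟨h1, h2, h3⟩ := hblock i
    exact funext fun r =>
      matA_mul_blockGen_pow_row (hf i).1.1 (hf i).2 rfl h1 h2 hsk (by omega) h3 j hj r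
  have hM : matM F s k h = Matrix.of fun r : Fin (s * k + h - 1) =>
      codeRow s k h (fun i : Fin (s - 1) => AdjoinRoot.powerBasis (hf i).1.1.ne_zero) none r :=
    funext fun r => matM_row r
  have ho : ∀ i : Fin (s - 1), 0 < orderOf (AdjoinRoot.root (f (i + 1))) := fun i => by
    obtain ⟨h1, h2, h3⟩ := hblock i
    rw [(hf i).1.2.2]
    have : 1 < Nat.card F := Finite.one_lt_card
    have := Nat.one_lt_pow (show (f (i + 1)).natDegree ≠ 0 by omega) this
    omega
  have hG : ∀ (i : Fin (s - 1)) {X}, (∃ g ∈ groupG F s k h (i + 1) (f (i + 1)),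
      (g : Matrix (Fin (s * k + h)) (Fin (s * k + h)) F) = X) ↔
        ∃ j : ℕ, blockGen F s k h (i + 1) (f (i + 1)) ^ j = X := fun i X => by
    obtain ⟨h1, h2, h3⟩ := hblock i
    exact exists_mem_groupG_iff (hf i).1.1 (by omega) (ho i)
  ext W
  constructor
  · rintro (⟨i, hi1, his, hW⟩ | hW)
    · obtain ⟨i, rfl⟩ : ∃ i' : Fin (s - 1), i = i' + 1 := ⟨⟨i - 1, by omega⟩, by simp; omega⟩
      rcases hW with ⟨g, hg, rfl⟩ | rfl
      · obtain ⟨j, hj⟩ := (hG i).1 ⟨g, hg, rfl⟩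
        refine ⟨some ⟨i, AdjoinRoot.root (f (i + 1)) ^ j⟩, ?_⟩
        rw [← hj]
        refine (hA i j (pow_ne_zero _ fun h0 => ?_)).symm
        have := ho i
        rw [h0, orderOf_zero] at this
        exact lt_irrefl _ this
      · exact ⟨_, (hB i).symm⟩
    · exact ⟨none, (hW.trans hM).symm⟩
  · rintro ⟨_ | ⟨i, β⟩, rfl⟩
    · exact Or.inr hM.symm
    · have hi := i.2
      refine Or.inl ⟨i + 1, by omega, by omega, ?_⟩
      by_cases hβ : β = 0
      · subst hβ
        exact Or.inr (hB i).symm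
      · obtain ⟨j, rfl⟩ := exists_root_pow_eq (hf i).1 hβ
        obtain ⟨g, hg, hgj⟩ := (hG i).2 ⟨j, rfl⟩
        refine Or.inl ⟨g, hg, ?_⟩
        rw [hgj]
        exact (hA i j hβ).symm

theorem card_index [∀ i : Fin (s - 1), Fact (Irreducible (f (i + 1)))]
    (hf : ∀ i : Fin (s - 1), IsPrimitivePolynomial (f (i + 1)) ∧
      (f (i + 1)).natDegree = (i + 1) * k + h) :
    Nat.card (Option (Σ i : Fin (s - 1), AdjoinRoot (f (i + 1)))) =
      (∑ i ∈ Finset.Icc 1 (s - 1), Fintype.card F ^ (i * k + h)) + 1 := by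
  have hfin : ∀ i : Fin (s - 1), Module.Finite F (AdjoinRoot (f (i + 1))) := fun i =>
    (AdjoinRoot.powerBasis (hf i).1.1.ne_zero).finite
  have : ∀ i : Fin (s - 1), Finite (AdjoinRoot (f (i + 1))) := fun i => Module.finite_of_finite F
  have hcard : ∀ i : Fin (s - 1),
      Nat.card (AdjoinRoot (f (i + 1))) = Fintype.card F ^ (((i : ℕ) + 1) * k + h) := fun i => by
    rw [Module.natCard_eq_pow_finrank (K := F),
      (AdjoinRoot.powerBasis (hf i).1.1.ne_zero).finrank, AdjoinRoot.powerBasis_dim, (hf i).2,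
      Nat.card_eq_fintype_card]
  rw [Finite.card_option, Nat.card_sigma, Finset.sum_congr rfl fun i _ => hcard i,
    Fin.sum_univ_eq_sum_range fun i => Fintype.card F ^ ((i + 1) * k + h), Finset.range_eq_Ico,
    Finset.sum_Ico_add' (fun i => Fintype.card F ^ (i * k + h)) 0 (s - 1) 1]
  rfl

end Codes

end FlagCodes

theorem theorem4p4 {F : Type*} [Field F] [Fintype F] (s k h : ℕ)
    (hs : 3 ≤ s) (hs4 : s ≠ 4) (hhk : h < k)
    (f : ℕ → Polynomial F)
    (hf : ∀ i, 1 ≤ i → i ≤ s - 1 →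
      FlagCodes.IsPrimitivePolynomial (f i) ∧ (f i).natDegree = i * k + h) :
    FlagCodes.IsFlagCode (FlagCodes.longType s k h)
        (FlagCodes.flagCode s k h f (FlagCodes.longType s k h)) ∧
      FlagCodes.IsCardinalityConsistent
        (FlagCodes.flagCode s k h f (FlagCodes.longType s k h)) ∧
      FlagCodes.HasMinDist (FlagCodes.flagCode s k h f (FlagCodes.longType s k h))
        (2 * k * (s + h + k - 2)) ∧
      (FlagCodes.flagCode s k h f (FlagCodes.longType s k h)).ncard =
        (∑ i ∈ Finset.Icc 1 (s - 1), Fintype.card F ^ (i * k + h)) + 1 ∧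
      (FlagCodes.flagCode s k h f (FlagCodes.fullType (s * k + h))).ncard =
        (∑ i ∈ Finset.Icc 1 (s - 1), Fintype.card F ^ (i * k + h)) + 1 ∧
      (FlagCodes.subspaceCode s k h f).ncard =
        (∑ i ∈ Finset.Icc 1 (s - 1), Fintype.card F ^ (i * k + h)) + 1 := by
  have hf' : ∀ i : Fin (s - 1), FlagCodes.IsPrimitivePolynomial (f (i + 1)) ∧
      (f (i + 1)).natDegree = (i + 1) * k + h := fun i => hf _ (by omega) (by omega)
  have : ∀ i : Fin (s - 1), Fact (Irreducible (f (i + 1))) := fun i => ⟨(hf' i).1.2.1⟩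
  have hsk : 3 * k ≤ s * k := Nat.mul_le_mul_right k hs
  obtain ⟨pb, hpb, hgen⟩ : ∃ pb : ∀ i : Fin (s - 1), PowerBasis F (AdjoinRoot (f (i + 1))),
      (∀ i, (pb i).dim = (i + 1) * k + h) ∧
      FlagCodes.generatorMatrices s k h f = Set.range fun x =>
        Matrix.of fun r : Fin (s * k + h - 1) => FlagCodes.codeRow s k h pb x r :=
    ⟨fun i => AdjoinRoot.powerBasis (hf' i).1.1.ne_zero,
      fun i => (AdjoinRoot.powerBasis_dim _).trans (hf' i).2,
      FlagCodes.generatorMatrices_eq_range hhk hf' (by omega)⟩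
  have hcode : ∀ {r : ℕ} (t : Fin r → ℕ), (∀ j, t j ≤ s * k + h - 1) →
      FlagCodes.flagCode s k h f t =
        Set.range fun x j => FlagCodes.prefixSpan F (FlagCodes.codeRow s k h pb x) (t j) := by
    intro r t ht
    rw [FlagCodes.flagCode, hgen, ← Set.range_comp]
    congr 1
    funext x j
    exact FlagCodes.rowSpaceFirst_of _ (ht j)
  have hspec := FlagCodes.longType_spec (s := s) (k := k) (h := h) hs hhk
  have hlong := hcode (FlagCodes.longType s k h) fun j => (hspec j).2.1
  have hdist : ∀ {x y}, x ≠ y → ∀ {t}, t ≤ s * k + h - 1 →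
      (t < k ∨ FlagCodes.IsCentralDim s k h t ∨ s * k + h ≤ t + k) →
      2 * min (min t k) (s * k + h - t) ≤
        FlagCodes.subspaceDist (FlagCodes.prefixSpan F (FlagCodes.codeRow s k h pb x) t)
          (FlagCodes.prefixSpan F (FlagCodes.codeRow s k h pb y) t) := fun hxy _ ht ht' =>
    FlagCodes.le_subspaceDist_codeRow hs hs4 hpb hhk ht ht' hxy
  -- a positive distance bound makes the prefixes injective in the index at each entry of the type
  have hinj : ∀ t, 1 ≤ t → t ≤ s * k + h - 1 →
      (t < k ∨ FlagCodes.IsCentralDim s k h t ∨ s * k + h ≤ t + k) →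
      Function.Injective fun x => FlagCodes.prefixSpan F (FlagCodes.codeRow s k h pb x) t := by
    intro t ht1 ht ht' x y hxy
    by_contra hne
    have h1 := hdist hne ht ht'
    simp only at hxy
    rw [hxy, FlagCodes.subspaceDist, sup_idem, inf_idem, Nat.sub_self] at h1
    omega
  have hcard := FlagCodes.card_index (s := s) (k := k) (h := h) hf'
  have hncard : ∀ {β : Type _} {g : Option (Σ i : Fin (s - 1), AdjoinRoot (f (i + 1))) → β},
      Function.Injective g → (Set.range g).ncard =
        (∑ i ∈ Finset.Icc 1 (s - 1), Fintype.card F ^ (i * k + h)) + 1 := by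
    intro β g hg
    rw [← hcard, ← Set.image_univ, Set.ncard_image_of_injective _ hg, Set.ncard_univ]
  have hpos : 0 < (k + h) + (s - 3) + k := by omega
  have hinjLong : Function.Injective fun x j =>
      FlagCodes.prefixSpan F (FlagCodes.codeRow s k h pb x) (FlagCodes.longType s k h j) :=
    fun x y hxy => hinj _ (hspec ⟨0, hpos⟩).1 (hspec ⟨0, hpos⟩).2.1 (hspec ⟨0, hpos⟩).2.2
      (congrFun hxy ⟨0, hpos⟩)
  refine ⟨⟨⟨FlagCodes.strictMono_longType hs hhk, fun j => ⟨(hspec j).1, ?_⟩⟩, ?_, ?_⟩, ?_, ⟨?_, ?_⟩,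
    ?_, ?_, ?_⟩
  · have := (hspec j).2.1
    omega
  · rw [hlong]
    exact ⟨_, ⟨none, rfl⟩⟩
  · rw [hlong]
    rintro _ ⟨x, rfl⟩
    have hfr := fun j => FlagCodes.finrank_prefixSpan_codeRow (F := F) hpb hhk (hspec j).2.1 x
    refine ⟨fun a b hab => ?_, fun j => ⟨?_, ?_, hfr j⟩⟩
    · have hlt := FlagCodes.strictMono_longType (s := s) (k := k) (h := h) hs hhk hab
      refine lt_of_le_of_ne (FlagCodes.prefixSpan_mono _ hlt.le) fun heq => ?_
      have h1 := congrArg (fun S : Submodule F (Fin (s * k + h) → F) => Module.finrank F S) heq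
      simp only [hfr] at h1
      omega
    · refine bot_lt_iff_ne_bot.2 fun heq => ?_
      have h1 := hfr j
      simp only at heq
      rw [heq, finrank_bot] at h1
      have := (hspec j).1
      omega
    · refine lt_top_iff_ne_top.2 fun heq => ?_
      have h1 := hfr j
      simp only at heq
      rw [heq, finrank_top, Module.finrank_fin_fun] at h1
      have := hspec j
      omega
  · intro j
    rw [FlagCodes.projectedCode, hlong, ← Set.range_comp, hncard hinjLong]
    exact hncard (hinj _ (hspec j).1 (hspec j).2.1 (hspec j).2.2)
  -- the minimum is attained by `A` and `B` of the largest block, where every summand is minimal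
  · let i : Fin (s - 1) := ⟨s - 2, by omega⟩
    have hne : (some ⟨i, 1⟩ : Option (Σ i : Fin (s - 1), AdjoinRoot (f (i + 1)))) ≠
        some ⟨i, 0⟩ := fun heq => by
      have := Option.some_injective _ heq
      rw [Sigma.mk.injEq] at this
      exact one_ne_zero (eq_of_heq this.2)
    rw [hlong]
    refine ⟨_, ⟨some ⟨i, 1⟩, rfl⟩, _, ⟨some ⟨i, 0⟩, rfl⟩, fun heq => hne (hinjLong heq), ?_⟩
    rw [← FlagCodes.sum_min_longType hs hhk, FlagCodes.flagDist]
    refine Finset.sum_congr rfl fun j _ => le_antisymm (hdist hne (hspec j).2.1 (hspec j).2.2) ?_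
    exact FlagCodes.subspaceDist_codeRow_last_le hs hpb hhk (hspec j).2.1 (by simp only [i]; omega)
  · rw [hlong]
    rintro _ ⟨_, ⟨x, rfl⟩, _, ⟨y, rfl⟩, hxy, rfl⟩
    rw [← FlagCodes.sum_min_longType hs hhk, FlagCodes.flagDist]
    refine Finset.sum_le_sum fun j _ => hdist (fun heq => hxy (by rw [heq])) (hspec j).2.1
      (hspec j).2.2
  · rw [hlong]
    exact hncard hinjLong
  · rw [hcode (FlagCodes.fullType (s * k + h)) fun j => by
      have := j.2
      simp only [FlagCodes.fullType]
      omega]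
    refine hncard fun x y hxy => ?_
    refine hinj (s * k + h - 1) (by omega) le_rfl (Or.inr (Or.inr (by omega))) ?_
    have h1 := congrFun hxy ⟨s * k + h - 2, by omega⟩
    simp only [FlagCodes.fullType] at h1
    rwa [show s * k + h - 2 + 1 = s * k + h - 1 by omega] at h1
  · rw [FlagCodes.subspaceCode, hgen, ← Set.range_comp]
    refine hncard fun x y hxy => ?_
    refine hinj (s * k + h - 1) (by omega) le_rfl (Or.inr (Or.inr (by omega))) ?_
    simpa only [Function.comp_apply, FlagCodes.rowSpace_of] using hxy
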